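/- **Cauchy–Frobenius Lemma for $\infty$-groupoids.** Work with $\infty$-groupoids (modelled by Kan complexes); pullbacks and fibres are homotopy pullbacks and homotopy fibres, and $\simeq$ denotes equivalence of $\infty$-groupoids. For an $\infty$-groupoid $X$ and a family $(F_x)_{x\in X}$ of $\infty$-groupoids, that is, a functor from $X$ to $\infty$-groupoids, let the homotopy sum $\int_{x\in X}F_x$ be its homotopy colimit; it comes with a projection to $X$. Let $\Lambda X$ be the free loop space of $X$, i.e. the pullback of the diagonal $\Delta:X\to X\times X$ along itself, with its projection to $X$, and let $\Omega_xX$ be the based loop space of $X$ at $x$, with its canonical map $\Omega_xX\to\Lambda X$. Let $f:E\to B$ be a map of $\infty$-groupoids, inducing $\Lambda f:\Lambda E\to\Lambda B$. For a point $b$ of $B$ let the incidence correspondence $\mathbb I_b\to\Omega_bB$ be the pullback of $\Lambda f$ along $\Omega_bB\to\Lambda B$, and for $\gamma\in\Omega_bB$ let $F^\gamma$ be the fibre of $\mathbb I_b\to\Omega_bB$ over $\gamma$; for $\gamma\in\Lambda B$ let $F^\gamma$ be the fibre of $\Lambda f$ over $\gamma$. For $\gamma\in\Omega_bB$ these two definitions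 agree: the fibre of $\mathbb I_b\to \Omega_bB$ over $\gamma$ is equivalent, over $\Lambda E$, to the fibre of $\Lambda f$ over the image of $\gamma$ in $\Lambda B$. Moreover: 1. (Formula 0) There are equivalences $$\int_{x\in E}\Omega_xE\;\simeq\;\Lambda E\;\simeq\;\int_{\gamma\in\Lambda B}F^\gamma ,$$ the first one over $E$ and the second one over $\Lambda B$. 2. (Formula 1) There are equivalences $$\int_{x\in E}\Omega_xE\;\simeq\;\Lambda E\;\simeq\;\int_{b\in B}\ \int_{\gamma\in\Omega_bB}F^\gamma ,$$ the first one over $E$ and the second one over $B$. -/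

import Mathlib

open CategoryTheory MonoidalCategory CartesianMonoidalCategory Simplicial Opposite

universe u

namespace HomotopySum

noncomputable section

/-! ### Weak equivalences

An ∞-groupoid is modelled by a Kan complex; an arbitrary simplicial set presents an ∞-groupoid
(its Kan replacement), and equivalences of ∞-groupoids are weak equivalences of simplicial sets. -/

/-- A map of simplicial sets is a weak (homotopy) equivalence if, for every Kan complex `K`, it
induces a bijection on the sets of homotopy classes of maps into `K`, that is, on the connected
components of the mapping complexes. -/
def IsWeakEquiv {X Y : SSet.{u}} (f : X ⟶ Y) : Prop :=
  ∀ (K : SSet.{u}) [SSet.KanComplex K],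
    Function.Bijective (SSet.mapπ₀ ((MonoidalClosed.pre f).app K))

/-- `a : A ⟶ X` and `z : Z ⟶ X` are equivalent over `X`: there is a weak equivalence `A ⟶ Z` which
commutes with the maps to `X` up to homotopy. -/
def EquivOver {A Z X : SSet.{u}} (a : A ⟶ X) (z : Z ⟶ X) : Prop :=
  ∃ w : A ⟶ Z, IsWeakEquiv w ∧ Nonempty (SSet.Homotopy a (w ≫ z))

/-! ### Pullbacks of ∞-groupoids -/

/-- Evaluation of paths in `X` at the endpoint `i`. -/
def endpoint (X : SSet.{u}) (i : Fin 2) : (ihom Δ[1]).obj X ⟶ X :=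
  lift (SSet.const (SSet.stdSimplex.obj₀Equiv.symm i)) (𝟙 _) ≫ (ihom.ev Δ[1]).app X

lemma endpoint_naturality {X Y : SSet.{u}} (f : X ⟶ Y) (i : Fin 2) :
    (ihom Δ[1]).map f ≫ endpoint Y i = endpoint X i ≫ f := by
  rfl

/-- The triples `(a, h, b)` where `h` is a path from `f a` to `g b`. -/
def hPullbackSub {A B C : SSet.{u}} (f : A ⟶ C) (g : B ⟶ C) :
    (A ⊗ ((ihom Δ[1]).obj C ⊗ B)).Subcomplex where
  obj n := { x | (endpoint C 0).app n x.2.1 = f.app n x.1 ∧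
    (endpoint C 1).app n x.2.1 = g.app n x.2.2 }
  map {n m} θ x hx := by
    obtain ⟨h₀, h₁⟩ := hx
    constructor
    · change (endpoint C 0).app m (((ihom Δ[1]).obj C).map θ x.2.1) = f.app m (A.map θ x.1)
      rw [NatTrans.naturality_apply, NatTrans.naturality_apply, h₀]
    · change (endpoint C 1).app m (((ihom Δ[1]).obj C).map θ x.2.1) = g.app m (B.map θ x.2.2)
      rw [NatTrans.naturality_apply, NatTrans.naturality_apply, h₁]

/-- The pullback of `f` and `g` in ∞-groupoids (the homotopy pullback): its points are the triples
`(a, h, b)` where `h` is a path from `f a` to `g b`. It has the correct homotopy type whenever `C`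
is a Kan complex. -/
def HPullback {A B C : SSet.{u}} (f : A ⟶ C) (g : B ⟶ C) : SSet.{u} :=
  (hPullbackSub f g).toSSet

namespace HPullback

section

variable {A B C : SSet.{u}} (f : A ⟶ C) (g : B ⟶ C)

/-- The first projection. -/
def fst : HPullback f g ⟶ A :=
  (hPullbackSub f g).ι ≫ CartesianMonoidalCategory.fst _ _

/-- The path component. -/
def path : HPullback f g ⟶ (ihom Δ[1]).obj C :=
  (hPullbackSub f g).ι ≫ CartesianMonoidalCategory.snd _ _ ≫ CartesianMonoidalCategory.fst _ _

/-- The second projection. -/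
def snd : HPullback f g ⟶ B :=
  (hPullbackSub f g).ι ≫ CartesianMonoidalCategory.snd _ _ ≫ CartesianMonoidalCategory.snd _ _

lemma path_zero : path f g ≫ endpoint C 0 = fst f g ≫ f := by
  ext n x
  exact x.2.1

lemma path_one : path f g ≫ endpoint C 1 = snd f g ≫ g := by
  ext n x
  exact x.2.2

variable {f g}

lemma hom_ext {Z : SSet.{u}} {p q : Z ⟶ HPullback f g} (h₁ : p ≫ fst f g = q ≫ fst f g)
    (h₂ : p ≫ path f g = q ≫ path f g) (h₃ : p ≫ snd f g = q ≫ snd f g) : p = q := by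
  refine (cancel_mono (hPullbackSub f g).ι).1 ?_
  refine CartesianMonoidalCategory.hom_ext _ _ h₁ (CartesianMonoidalCategory.hom_ext _ _ ?_ ?_)
  · exact h₂
  · exact h₃

/-- The map into the homotopy pullback with the three given components. -/
def lift {Z : SSet.{u}} (p : Z ⟶ A) (h : Z ⟶ (ihom Δ[1]).obj C) (q : Z ⟶ B)
    (h₀ : h ≫ endpoint C 0 = p ≫ f) (h₁ : h ≫ endpoint C 1 = q ≫ g) : Z ⟶ HPullback f g :=
  SSet.Subcomplex.lift (CartesianMonoidalCategory.lift p (CartesianMonoidalCategory.lift h q)) (by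
    rintro n _ ⟨z, rfl⟩
    exact ⟨ConcreteCategory.congr_hom (NatTrans.congr_app h₀ n) z,
      ConcreteCategory.congr_hom (NatTrans.congr_app h₁ n) z⟩)

@[simp]
lemma lift_fst {Z : SSet.{u}} (p : Z ⟶ A) (h : Z ⟶ (ihom Δ[1]).obj C) (q : Z ⟶ B)
    (h₀ : h ≫ endpoint C 0 = p ≫ f) (h₁ : h ≫ endpoint C 1 = q ≫ g) :
    lift p h q h₀ h₁ ≫ fst f g = p := by
  rfl

@[simp]
lemma lift_path {Z : SSet.{u}} (p : Z ⟶ A) (h : Z ⟶ (ihom Δ[1]).obj C) (q : Z ⟶ B)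
    (h₀ : h ≫ endpoint C 0 = p ≫ f) (h₁ : h ≫ endpoint C 1 = q ≫ g) :
    lift p h q h₀ h₁ ≫ path f g = h := by
  rfl

@[simp]
lemma lift_snd {Z : SSet.{u}} (p : Z ⟶ A) (h : Z ⟶ (ihom Δ[1]).obj C) (q : Z ⟶ B)
    (h₀ : h ≫ endpoint C 0 = p ≫ f) (h₁ : h ≫ endpoint C 1 = q ≫ g) :
    lift p h q h₀ h₁ ≫ snd f g = q := by
  rfl

end

/-- Functoriality of homotopy pullbacks in the cospan. -/
def map {A B C A' B' C' : SSet.{u}} {f : A ⟶ C} {g : B ⟶ C} {f' : A' ⟶ C'} {g' : B' ⟶ C'}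
    (α : A ⟶ A') (β : B ⟶ B') (γ : C ⟶ C') (hf : f ≫ γ = α ≫ f') (hg : g ≫ γ = β ≫ g') :
    HPullback f g ⟶ HPullback f' g' :=
  lift (fst f g ≫ α) (path f g ≫ (ihom Δ[1]).map γ) (snd f g ≫ β)
    (by rw [Category.assoc, endpoint_naturality, ← Category.assoc, path_zero, Category.assoc, hf,
      Category.assoc])
    (by rw [Category.assoc, endpoint_naturality, ← Category.assoc, path_one, Category.assoc, hg,
      Category.assoc])

section

variable {A B C A' B' C' : SSet.{u}} {f : A ⟶ C} {g : B ⟶ C} {f' : A' ⟶ C'} {g' : B' ⟶ C'}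
  (α : A ⟶ A') (β : B ⟶ B') (γ : C ⟶ C') (hf : f ≫ γ = α ≫ f') (hg : g ≫ γ = β ≫ g')

@[simp]
lemma map_fst : map α β γ hf hg ≫ fst f' g' = fst f g ≫ α := rfl

@[simp]
lemma map_path : map α β γ hf hg ≫ path f' g' = path f g ≫ (ihom Δ[1]).map γ := rfl

@[simp]
lemma map_snd : map α β γ hf hg ≫ snd f' g' = snd f g ≫ β := rfl

@[simp]
lemma map_fst_assoc {Z : SSet.{u}} (h : A' ⟶ Z) :
    map α β γ hf hg ≫ fst f' g' ≫ h = fst f g ≫ α ≫ h := rfl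

@[simp]
lemma map_path_assoc {Z : SSet.{u}} (h : (ihom Δ[1]).obj C' ⟶ Z) :
    map α β γ hf hg ≫ path f' g' ≫ h = path f g ≫ (ihom Δ[1]).map γ ≫ h := rfl

@[simp]
lemma map_snd_assoc {Z : SSet.{u}} (h : B' ⟶ Z) :
    map α β γ hf hg ≫ snd f' g' ≫ h = snd f g ≫ β ≫ h := rfl

end

end HPullback

/-! ### Free loop spaces -/

/-- The diagonal of `X`. -/
def diag (X : SSet.{u}) : X ⟶ X ⊗ X := CartesianMonoidalCategory.lift (𝟙 X) (𝟙 X)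

lemma diag_naturality {X Y : SSet.{u}} (f : X ⟶ Y) : diag X ≫ (f ⊗ₘ f) = f ≫ diag Y := by
  rfl

/-- The free loop space `Λ X`: the pullback of the diagonal of `X` along itself. -/
def freeLoop : SSet.{u} ⥤ SSet.{u} where
  obj X := HPullback (diag X) (diag X)
  map f := HPullback.map f f (f ⊗ₘ f) (diag_naturality f) (diag_naturality f)
  map_id X := by apply HPullback.hom_ext <;> simp
  map_comp f g := by
    apply HPullback.hom_ext
    · simp
    · simp [← Functor.map_comp]
    · simp

/-- The projection `Λ X ⟶ X`. -/
def freeLoopProj (X : SSet.{u}) : freeLoop.obj X ⟶ X := HPullback.fst _ _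

/-! ### Pointed maps and the constructions made from them -/

/-- A map `E ⟶ B` together with a point of `B`. -/
structure PointedMap where
  {E B : SSet.{u}}
  /-- The map. -/
  map : E ⟶ B
  /-- The point. -/
  pt : 𝟙_ SSet.{u} ⟶ B

namespace PointedMap

/-- Commutative squares which preserve the points. -/
@[ext]
structure Hom (P Q : PointedMap.{u}) where
  left : P.E ⟶ Q.E
  right : P.B ⟶ Q.B
  comm : P.map ≫ right = left ≫ Q.map
  pt : P.pt ≫ right = Q.pt

instance : Category PointedMap.{u} where
  Hom := Hom
  id P := { left := 𝟙 _, right := 𝟙 _, comm := by simp, pt := by simp }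
  comp f g :=
    { left := f.left ≫ g.left
      right := f.right ≫ g.right
      comm := by rw [← Category.assoc, f.comm, Category.assoc, g.comm, Category.assoc]
      pt := by rw [← Category.assoc, f.pt, g.pt] }

@[ext]
lemma hom_ext {P Q : PointedMap.{u}} {f g : P ⟶ Q} (h₁ : f.left = g.left)
    (h₂ : f.right = g.right) : f = g :=
  Hom.ext h₁ h₂

@[simp] lemma id_left (P : PointedMap.{u}) : Hom.left (𝟙 P) = 𝟙 P.E := rfl
@[simp] lemma id_right (P : PointedMap.{u}) : Hom.right (𝟙 P) = 𝟙 P.B := rfl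
@[simp] lemma comp_left {P Q R : PointedMap.{u}} (f : P ⟶ Q) (g : Q ⟶ R) :
    Hom.left (f ≫ g) = Hom.left f ≫ Hom.left g := rfl
@[simp] lemma comp_right {P Q R : PointedMap.{u}} (f : P ⟶ Q) (g : Q ⟶ R) :
    Hom.right (f ≫ g) = Hom.right f ≫ Hom.right g := rfl

/-- The (homotopy) fibre of `E ⟶ B` over the point of `B`. -/
def fibre : PointedMap.{u} ⥤ SSet.{u} where
  obj P := HPullback P.pt P.map
  map φ := HPullback.map (𝟙 _) φ.left φ.right (by rw [φ.pt, Category.id_comp]) φ.comm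
  map_id P := by apply HPullback.hom_ext <;> simp
  map_comp φ ψ := by apply HPullback.hom_ext <;> simp

/-- The projection of the fibre to `E`. -/
def fibreToE (P : PointedMap.{u}) : fibre.obj P ⟶ P.E := HPullback.snd P.pt P.map

/-- The based loop space `Ω_b B`, where `b` is the point of `B`: the pullback of
`b : 1 ⟶ B` along itself. -/
def loop : PointedMap.{u} ⥤ SSet.{u} where
  obj P := HPullback P.pt P.pt
  map φ := HPullback.map (𝟙 _) (𝟙 _) φ.right (by rw [φ.pt, Category.id_comp])
    (by rw [φ.pt, Category.id_comp])
  map_id P := by apply HPullback.hom_ext <;> simp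
  map_comp φ ψ := by apply HPullback.hom_ext <;> simp

end PointedMap

/-- A path `h` in `X` gives the path in `X × X` whose first component is `h` and whose second
component is constant at the starting point of `h`. -/
def pathConst (X : SSet.{u}) : (ihom Δ[1]).obj X ⟶ (ihom Δ[1]).obj (X ⊗ X) :=
  MonoidalClosed.curry (CartesianMonoidalCategory.lift ((ihom.ev Δ[1]).app X)
    (CartesianMonoidalCategory.snd _ _ ≫ endpoint X 0))

lemma pathConst_endpoint (X : SSet.{u}) (i : Fin 2) :
    pathConst X ≫ endpoint (X ⊗ X) i =
      CartesianMonoidalCategory.lift (endpoint X i) (endpoint X 0) := by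
  rfl

lemma pathConst_naturality {X Y : SSet.{u}} (f : X ⟶ Y) :
    pathConst X ≫ (ihom Δ[1]).map (f ⊗ₘ f) = (ihom Δ[1]).map f ≫ pathConst Y := by
  rfl

namespace PointedMap

/-- The inclusion `Ω_b B ⟶ Λ B` of the based loops into the free loops: a loop `h` at `b` is sent
to the pair of paths from `b` to `b` formed by `h` and the constant path. -/
def loopToFreeLoop (P : PointedMap.{u}) : loop.obj P ⟶ freeLoop.obj P.B :=
  HPullback.lift (HPullback.fst _ _ ≫ P.pt) (HPullback.path _ _ ≫ pathConst P.B)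
    (HPullback.snd _ _ ≫ P.pt)
    (by
      have h := HPullback.path_zero P.pt P.pt
      exact CartesianMonoidalCategory.hom_ext _ _ h h)
    (by
      have h := HPullback.path_zero P.pt P.pt
      have h' := HPullback.path_one P.pt P.pt
      exact CartesianMonoidalCategory.hom_ext _ _ h' h)

lemma loopToFreeLoop_naturality {P Q : PointedMap.{u}} (φ : P ⟶ Q) :
    loop.map φ ≫ Q.loopToFreeLoop = P.loopToFreeLoop ≫ freeLoop.map φ.right := by
  apply HPullback.hom_ext
  · change HPullback.fst _ _ ≫ Q.pt = (HPullback.fst _ _ ≫ P.pt) ≫ φ.right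
    rw [Category.assoc, φ.pt]
  · rfl
  · change HPullback.snd _ _ ≫ Q.pt = (HPullback.snd _ _ ≫ P.pt) ≫ φ.right
    rw [Category.assoc, φ.pt]

/-- The incidence correspondence `𝕀_b`: the pullback of `Ω_b B ⟶ Λ B ⟵ Λ E`. -/
def incidence : PointedMap.{u} ⥤ SSet.{u} where
  obj P := HPullback P.loopToFreeLoop (freeLoop.map P.map)
  map φ := HPullback.map (loop.map φ) (freeLoop.map φ.left) (freeLoop.map φ.right)
    (loopToFreeLoop_naturality φ).symm (by rw [← Functor.map_comp, ← Functor.map_comp, φ.comm])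
  map_id P := by apply HPullback.hom_ext <;> simp
  map_comp φ ψ := by apply HPullback.hom_ext <;> simp

/-- The projection `𝕀_b ⟶ Ω_b B`. -/
def incidenceToLoop : incidence.{u} ⟶ loop where
  app P := HPullback.fst P.loopToFreeLoop (freeLoop.map P.map)

/-- The projection `𝕀_b ⟶ Λ E`. -/
def incidenceToFreeLoop (P : PointedMap.{u}) : incidence.obj P ⟶ freeLoop.obj P.E :=
  HPullback.snd P.loopToFreeLoop (freeLoop.map P.map)

/-- The map `𝕀_b ⟶ Ω_b B`, as a functor of the pointed map. -/
def incidenceArrow : PointedMap.{u} ⥤ Arrow SSet.{u} where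
  obj P := Arrow.mk (incidenceToLoop.app P)
  map φ := Arrow.homMk (incidence.map φ) (loop.map φ) (incidenceToLoop.naturality φ)

end PointedMap

/-! ### Homotopy sums -/

section

variable {X : SSet.{u}}

lemma total_ext (G : X.Elements ⥤ Type u) {n : SimplexCategoryᵒᵖ}
    {σ τ : X.obj n} {a : G.obj (X.elementsMk n σ)} {b : G.obj (X.elementsMk n τ)} (h : σ = τ)
    (h' : G.map (CategoryOfElements.homMk (X.elementsMk n σ) (X.elementsMk n τ) (𝟙 n)
      (by simpa using h)) a = b) :
    (⟨σ, a⟩ : Σ σ : X.obj n, G.obj (X.elementsMk n σ)) = ⟨τ, b⟩ := by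
  obtain rfl : σ = τ := h
  have e : CategoryOfElements.homMk (X.elementsMk n σ) (X.elementsMk n σ) (𝟙 n) (by simp) =
    𝟙 (X.elementsMk n σ) := rfl
  rw [e, G.map_id] at h'
  exact congrArg _ h'

/-- The simplicial set `n ↦ ∐_{σ ∈ X_n} G σ` given by a functor `G` on the opposite `X.Elements` of
the category of simplices of `X`. -/
def total (G : X.Elements ⥤ Type u) : SSet.{u} where
  obj n := Σ σ : X.obj n, G.obj (X.elementsMk n σ)
  map {n m} θ := ↾fun x ↦ ⟨X.map θ x.1, G.map (CategoryOfElements.homMk (X.elementsMk n x.1)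
    (X.elementsMk m (X.map θ x.1)) θ rfl) x.2⟩
  map_id n := by
    apply ConcreteCategory.hom_ext
    rintro ⟨σ, a⟩
    refine total_ext G (by simp) ?_
    have h : ∀ {q : X.Elements} (α : X.elementsMk n σ ⟶ q) (β : q ⟶ X.elementsMk n σ)
        (_ : α ≫ β = 𝟙 _), G.map β (G.map α a) = a := by
      intro q α β e
      rw [← ConcreteCategory.comp_apply, ← G.map_comp, e, G.map_id]
      rfl
    exact h _ _ (CategoryOfElements.ext _ _ _ (Category.comp_id (𝟙 n)))
  map_comp {n m k} θ θ' := by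
    apply ConcreteCategory.hom_ext
    rintro ⟨σ, a⟩
    refine total_ext G (Functor.map_comp_apply X θ θ' σ) ?_
    have h : ∀ {p q r : X.Elements} (α : X.elementsMk n σ ⟶ p) (α' : p ⟶ q)
        (β : X.elementsMk n σ ⟶ r) (β' : r ⟶ q) (_ : α ≫ α' = β ≫ β'),
        G.map α' (G.map α a) = G.map β' (G.map β a) := by
      intro p q r α α' β β' e
      rw [← ConcreteCategory.comp_apply, ← G.map_comp, e, G.map_comp]
      rfl
    exact h _ _ _ _ (CategoryOfElements.ext _ _ _ (Category.comp_id (θ ≫ θ')))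

/-- The diagonal: the functor `σ ↦ (F σ)_n`, where `n` is the dimension of `σ`. -/
def diagonal (F : X.Elements ⥤ SSet.{u}) : X.Elements ⥤ Type u where
  obj p := (F.obj p).obj p.1
  map {p q} α := (F.obj p).map α.1 ≫ (F.map α).app q.1
  map_id p := by
    rw [F.map_id]
    exact (F.obj p).map_id p.1
  map_comp {p q r} α β := by
    rw [F.map_comp, CategoryOfElements.comp_val, Functor.map_comp]
    have h := (F.map α).naturality β.1
    rw [Category.assoc, Category.assoc, ← reassoc_of% h]
    rfl

/-- The homotopy sum `∫_{x ∈ X} F x` of a family `F` of ∞-groupoids indexed by `X`: the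
homotopy colimit of `F`. The category `X.Elements` is the opposite of the category of simplices of
`X`; its localization at all morphisms is the ∞-groupoid `X`, so that a functor from `X` to
∞-groupoids is the same thing as a functor `F` on `X.Elements` which sends all morphisms to weak
equivalences, the value of the family at the point `x` being the value of `F` at the vertex `x`.
The homotopy colimit of `F` is the geometric realization, that is, the diagonal
`n ↦ ∐_{σ ∈ X_n} (F σ)_n`, of the simplicial space `n ↦ ∐_{σ ∈ X_n} F σ`. -/
def homotopySum (X : SSet.{u}) (F : X.Elements ⥤ SSet.{u}) : SSet.{u} := total (diagonal F)

end

/-- The projection of the homotopy sum of a family to the ∞-groupoid which indexes it. -/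
def homotopySumProj (X : SSet.{u}) (F : X.Elements ⥤ SSet.{u}) : homotopySum X F ⟶ X where
  app _ := ↾fun x ↦ x.1
  naturality _ _ _ := rfl

lemma curry'_pre {K L X : SSet.{u}} (g : L ⟶ K) (σ : K ⟶ X) :
    MonoidalClosed.curry' σ ≫ (MonoidalClosed.pre g).app X = MonoidalClosed.curry' (g ≫ σ) := by
  rw [MonoidalClosed.curry', MonoidalClosed.curry_pre_app, MonoidalClosed.curry']
  congr 1

/-- The tautological family of pointed maps `x ↦ (E ⟶ B, x)` indexed by the points `x` of `B`.
On an `n`-simplex `σ` of `B`, it is the map of mapping complexes `E ^ Δ[n] ⟶ B ^ Δ[n]`, which is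
equivalent to `E ⟶ B`, pointed by `σ`. Every construction on pointed maps thus yields a family
indexed by `B`. -/
def tautological {E B : SSet.{u}} (f : E ⟶ B) : B.Elements ⥤ PointedMap.{u} where
  obj p :=
    { map := (ihom (SSet.stdSimplex.obj p.1.unop)).map f
      pt := MonoidalClosed.curry' (SSet.yonedaEquiv.symm p.2) }
  map {p q} θ :=
    { left := (MonoidalClosed.pre (SSet.stdSimplex.map θ.1.unop)).app E
      right := (MonoidalClosed.pre (SSet.stdSimplex.map θ.1.unop)).app B
      comm := (MonoidalClosed.pre (SSet.stdSimplex.map θ.1.unop)).naturality f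
      pt := by
        rw [curry'_pre, SSet.yonedaEquiv_symm_naturality_left]
        exact congrArg (fun σ => MonoidalClosed.curry' (SSet.yonedaEquiv.symm σ)) θ.2 }
  map_id p := by
    have h : MonoidalClosed.pre (SSet.stdSimplex.map (𝟙 p.1.unop)) =
        𝟙 (ihom (SSet.stdSimplex.{u}.obj p.1.unop)) := by
      exact (congrArg _ (SSet.stdSimplex.map_id _)).trans (MonoidalClosed.pre_id _)
    exact PointedMap.hom_ext (NatTrans.congr_app h E) (NatTrans.congr_app h B)
  map_comp θ θ' := by
    have h : MonoidalClosed.pre (SSet.stdSimplex.{u}.map (θ'.1.unop ≫ θ.1.unop)) =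
        MonoidalClosed.pre (SSet.stdSimplex.map θ.1.unop) ≫
          MonoidalClosed.pre (SSet.stdSimplex.map θ'.1.unop) := by
      exact (congrArg _ (SSet.stdSimplex.map_comp _ _)).trans (MonoidalClosed.pre_map _ _)
    exact PointedMap.hom_ext (NatTrans.congr_app h E) (NatTrans.congr_app h B)

/-- A commutative square from `q` to `q'` gives a morphism of tautological families. -/
def tautologicalMap {q q' : Arrow SSet.{u}} (φ : q ⟶ q') :
    tautological q.hom ⟶ NatTrans.mapElements φ.right ⋙ tautological q'.hom where
  app p :=
    { left := (ihom (SSet.stdSimplex.obj p.1.unop)).map φ.left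
      right := (ihom (SSet.stdSimplex.obj p.1.unop)).map φ.right
      comm := by
        change (ihom _).map _ ≫ (ihom _).map _ = (ihom _).map _ ≫ (ihom _).map _
        rw [← Functor.map_comp, ← Functor.map_comp]
        exact congrArg _ φ.w.symm
      pt := by
        change MonoidalClosed.curry' _ ≫ _ = MonoidalClosed.curry' _
        rw [MonoidalClosed.curry'_ihom_map, SSet.yonedaEquiv_symm_comp]
        rfl }
  naturality p p' θ := by
    apply PointedMap.hom_ext
    · exact ((MonoidalClosed.pre (SSet.stdSimplex.map θ.1.unop)).naturality φ.left).symm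
    · exact ((MonoidalClosed.pre (SSet.stdSimplex.map θ.1.unop)).naturality φ.right).symm

/-- The family `x ↦ Y_x` of the (homotopy) fibres of a map `q : Y ⟶ X`, indexed by `X`. -/
def fibreFamily {Y X : SSet.{u}} (q : Y ⟶ X) : X.Elements ⥤ SSet.{u} :=
  tautological q ⋙ PointedMap.fibre

lemma fibreFamily_ext {Y X : SSet.{u}} (q : Y ⟶ X) {n : SimplexCategoryᵒᵖ} {σ τ : X.obj n}
    {a : (diagonal (fibreFamily q)).obj (X.elementsMk n σ)}
    {b : (diagonal (fibreFamily q)).obj (X.elementsMk n τ)} (h : σ = τ) (h' : a.1 = b.1) :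
    (⟨σ, a⟩ : Σ σ : X.obj n, (diagonal (fibreFamily q)).obj (X.elementsMk n σ)) = ⟨τ, b⟩ := by
  obtain rfl : σ = τ := h
  exact congrArg _ (Subtype.ext h')

/-- The homotopy sum of the fibres of a map, functorially in the map. -/
def fibreSum : Arrow SSet.{u} ⥤ SSet.{u} where
  obj q := homotopySum q.right (fibreFamily q.hom)
  map {q q'} φ :=
    { app n := ↾fun x ↦ ⟨φ.right.app n x.1, (PointedMap.fibre.map
        ((tautologicalMap φ).app (q.right.elementsMk n x.1))).app n x.2⟩
      naturality n m θ := by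
        apply ConcreteCategory.hom_ext
        rintro ⟨σ, a⟩
        exact fibreFamily_ext q'.hom (NatTrans.naturality_apply φ.right θ σ) rfl }
  map_id q := by
    ext n ⟨σ, a⟩
    exact fibreFamily_ext q.hom rfl rfl
  map_comp {q q' q''} φ ψ := by
    ext n ⟨σ, a⟩
    exact fibreFamily_ext q''.hom rfl rfl

/-- The family `x ↦ Ω_x E` of the based loop spaces of `E`, indexed by `E`. -/
def loopFamily (E : SSet.{u}) : E.Elements ⥤ SSet.{u} :=
  tautological (𝟙 E) ⋙ PointedMap.loop

/-- The family `b ↦ ∫_{γ ∈ Ω_b B} F^γ` indexed by `B`, where `F^γ` is the fibre over `γ` of the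
incidence correspondence `𝕀_b ⟶ Ω_b B`. -/
def fixpointSumFamily {E B : SSet.{u}} (f : E ⟶ B) : B.Elements ⥤ SSet.{u} :=
  tautological f ⋙ PointedMap.incidenceArrow ⋙ fibreSum

end

end HomotopySum

open HomotopySum

namespace HomotopySum

noncomputable section

/-! ### Elements of mapping complexes -/

/-! Everything rests on one model of homotopy sums. An `n`-simplex of `homotopySum X F` is an
`n`-simplex `σ` of `X` with an `n`-simplex of `F σ`. If `F σ` is the simplicial set of maps `Δ[n] ⟶
T` over `σ`, for a fixed `π : T ⟶ X` (a `SectionFamily`), this is the same as a map `Δ[n] × Δ[n] ⟶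
T` lying over `σ` through the first factor. Restriction to the diagonal then gives a map from the
sum to `T`, strictly over `X`. It is a homotopy equivalence: its inverse makes a simplex constant in
the second variable, and `y (a, b)` is joined to `y (a, a)` through `y (a, max a b)`
(`PartialSection.isWeakEquiv_toTotal`, `SectionFamily.isWeakEquiv_toTotal`).

All the families in question have this form, because paths and homotopy pullbacks commute with
mapping complexes out of `Δ[n]` (the calculus of `IsEvaluation`). For the fibres of `q : Y ⟶ X`, `T`
is the path fibration `HPullback (𝟙 X) q`, which contracts to `Y`. For based loops, `T` is the space
`StrictLoop E` of paths with equal ends. For the incidence correspondences, `T` is the homotopy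
pullback of `StrictLoop B` and `Λ E` over `Λ B`.

It remains to compare `T` with `Λ E`. The Kan condition lets a path be dragged along prescribed
motions of its ends (`exists_path_lift`). Hence strict loops form a deformation retract of the space
`Λ X` of pairs of parallel paths, and deformation retracts are preserved by base change along path
fibrations (`DeformationRetract.isWeakEquiv_snd`). The same dragging compares the two descriptions
of `F^γ` (`nonempty_deformationRetract_iteratedLift`).

In the iterated sum, the inner sum of the fibres of `𝕀_b ⟶ Ω_b B` has to be replaced by `𝕀_b` for
all `b` at once. The equivalence for fibres is therefore made natural in the map, together with its
homotopies, and natural homotopies pass to homotopy sums (`isWeakEquiv_homotopySumMap`). -/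

lemma congr_app_pair {A B C : SSet.{u}} {f g : A ⊗ B ⟶ C} (h : f = g) {n : SimplexCategoryᵒᵖ}
    (a : A.obj n) (b : B.obj n) : f.app n (a, b) = g.app n (a, b) := by
  rw [h]

lemma naturality_pair {A B C : SSet.{u}} (f : A ⊗ B ⟶ C) {n m : SimplexCategoryᵒᵖ} (θ : n ⟶ m)
    (a : A.obj n) (b : B.obj n) :
    f.app m (A.map θ a, B.map θ b) = C.map θ (f.app n (a, b)) := by
  have h (x : (A ⊗ B).obj n) : f.app m ((A ⊗ B).map θ x) = C.map θ (f.app n x) :=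
    NatTrans.naturality_apply f θ x
  exact h (a, b)

/-- The evaluation map sees only the component of a simplex at the identity; applied to the
restriction of `y` along `α` it reaches the component at `α`. -/
lemma pre_app {A B X : SSet.{u}} (f : A ⟶ B) {n d : SimplexCategoryᵒᵖ}
    (y : ((ihom B).obj X).obj n) (α : n ⟶ d) (a : A.obj d) :
    (((MonoidalClosed.pre f).app X).app n y).app d α a = y.app d α (f.app d a) := by
  have h := congr_app_pair (MonoidalClosed.id_tensor_pre_app_comp_ev f X) a
    (((ihom B).obj X).map α y)
  have h' := NatTrans.naturality_apply ((MonoidalClosed.pre f).app X) α y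
  change (((MonoidalClosed.pre f).app X).app d (((ihom B).obj X).map α y)).app d (𝟙 d) a =
    y.app d (α ≫ 𝟙 d) (f.app d a) at h
  rw [h'] at h
  change (((MonoidalClosed.pre f).app X).app n y).app d (α ≫ 𝟙 d) a = _ at h
  rwa [Category.comp_id] at h

lemma ihom_ext {A X : SSet.{u}} {n : SimplexCategoryᵒᵖ} {y z : ((ihom A).obj X).obj n}
    (h : ∀ (d : SimplexCategoryᵒᵖ) (α : n ⟶ d) (a : A.obj d), y.app d α a = z.app d α a) :
    y = z := by
  apply Functor.functorHom_ext
  intro d α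
  ext a
  exact h d α a

lemma ihom_naturality {A X : SSet.{u}} {n d e : SimplexCategoryᵒᵖ} (y : ((ihom A).obj X).obj n)
    (α : n ⟶ d) (β : d ⟶ e) (a : A.obj d) :
    y.app e (α ≫ β) (A.map β a) = X.map β (y.app d α a) :=
  ConcreteCategory.congr_hom (y.naturality β α) a

/-! ### Homotopies and weak equivalences -/

/-- Constructor for homotopies. -/
def homotopyMk {X Y : SSet.{u}} {f g : X ⟶ Y} (h : X ⊗ Δ[1] ⟶ Y) (h₀ : SSet.ι₀ ≫ h = f)
    (h₁ : SSet.ι₁ ≫ h = g) : SSet.Homotopy f g where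
  h := h
  h₀ := h₀
  h₁ := h₁
  rel := by
    ext n ⟨⟨x, hx⟩, _⟩
    exact hx.elim

lemma homotopy_of_eq {X Y : SSet.{u}} {f g : X ⟶ Y} (h : f = g) : Nonempty (SSet.Homotopy f g) :=
  ⟨homotopyMk (fst _ _ ≫ f) rfl h⟩

/-- Two maps are weakly homotopic if they induce the same map on homotopy classes of maps to any
Kan complex. -/
def WeakHomotopic {X Y : SSet.{u}} (f g : X ⟶ Y) : Prop :=
  ∀ (K : SSet.{u}) [SSet.KanComplex K],
    SSet.mapπ₀ ((MonoidalClosed.pre f).app K) = SSet.mapπ₀ ((MonoidalClosed.pre g).app K)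

namespace WeakHomotopic

lemma refl {X Y : SSet.{u}} (f : X ⟶ Y) : WeakHomotopic f f := fun _ _ ↦ rfl

lemma symm {X Y : SSet.{u}} {f g : X ⟶ Y} (h : WeakHomotopic f g) : WeakHomotopic g f :=
  fun K _ ↦ (h K).symm

lemma trans {X Y : SSet.{u}} {f g k : X ⟶ Y} (h : WeakHomotopic f g) (h' : WeakHomotopic g k) :
    WeakHomotopic f k :=
  fun K _ ↦ (h K).trans (h' K)

/-- A vertex `v` of the mapping complex, composed with the homotopy, becomes an edge between the two
composites, and `π₀` identifies the ends of an edge. -/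
lemma of_homotopy {X Y : SSet.{u}} {f g : X ⟶ Y} (h : X ⊗ Δ[1] ⟶ Y) (h₀ : SSet.ι₀ ≫ h = f)
    (h₁ : SSet.ι₁ ≫ h = g) : WeakHomotopic f g := by
  subst h₀ h₁
  intro K _
  funext x
  induction x with | _ v
  -- The components of the vertex `v` are indexed by the unique map to `⦋0⦌`; the index `α` of the
  -- edge enters as the `Δ[1]`-coordinate of `h`.
  let e : ((ihom X).obj K) _⦋1⦌ :=
    { app := fun d α ↦ ↾fun x ↦ v.app d (SimplexCategory.const d.unop ⦋0⦌ 0).op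
        (h.app d (x, SSet.stdSimplex.objEquiv.symm α.unop))
      naturality := by
        intro c d f a
        ext x
        have h₁ := naturality_pair h f x (SSet.stdSimplex.objEquiv.symm a.unop : Δ[1].obj c)
        have h₂ := ihom_naturality v (SimplexCategory.const c.unop ⦋0⦌ 0).op f
          (h.app c (x, (SSet.stdSimplex.objEquiv.symm a.unop : Δ[1].obj c)))
        rw [← h₁] at h₂
        exact h₂ }
  have key (i : Fin 2) (j : X ⟶ X ⊗ Δ[1])
      (hj : ∀ (d : SimplexCategoryᵒᵖ) (x : X.obj d),
        j.app d x = (x, SSet.stdSimplex.const 1 i d)) (k : ⦋0⦌ ⟶ ⦋1⦌) (hk : k.toOrderHom 0 = i) :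
      ((ihom X).obj K).map k.op e = ((MonoidalClosed.pre (j ≫ h)).app K).app _ v := by
    apply ihom_ext
    intro d α x
    rw [pre_app]
    have h₁ : (SimplexCategory.const d.unop ⦋0⦌ 0).op = α := by
      apply Quiver.Hom.unop_inj
      ext i
      simp
    have h₂ : (SSet.stdSimplex.objEquiv.symm (k.op ≫ α).unop : Δ[1].obj d) =
        SSet.stdSimplex.const 1 i d := by
      subst hk
      apply SSet.stdSimplex.objEquiv.injective
      ext i
      change ((k.toOrderHom (α.unop.toOrderHom i)) : ℕ) = k.toOrderHom 0
      rw [Fin.eq_zero (α.unop.toOrderHom i : Fin 1)]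
    change v.app d (SimplexCategory.const d.unop ⦋0⦌ 0).op (h.app d
      (x, SSet.stdSimplex.objEquiv.symm (k.op ≫ α).unop)) = v.app d α (h.app d (j.app d x))
    rw [h₁, h₂, hj]
  -- The face opposite to the vertex `1` is the source of the edge, so `δ 1` goes with `ι₀` and `δ
  -- 0` with `ι₁`.
  exact SSet.π₀.sound (SSet.Edge.mk e
    (key 0 SSet.ι₀ (fun _ _ ↦ rfl) (SimplexCategory.δ 1) rfl)
    (key 1 SSet.ι₁ (fun _ _ ↦ rfl) (SimplexCategory.δ 0) rfl))

end WeakHomotopic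

lemma isWeakEquiv_of_weakHomotopic {X Y : SSet.{u}} (f : X ⟶ Y) (g : Y ⟶ X)
    (h : WeakHomotopic (f ≫ g) (𝟙 X)) (h' : WeakHomotopic (g ≫ f) (𝟙 Y)) : IsWeakEquiv f := by
  intro K _
  refine Function.bijective_iff_has_inverse.2
    ⟨SSet.mapπ₀ ((MonoidalClosed.pre g).app K), fun x ↦ ?_, fun x ↦ ?_⟩
  · have := congrFun (h' K) x
    simpa only [MonoidalClosed.pre_map, NatTrans.comp_app, SSet.mapπ₀_comp_apply,
      MonoidalClosed.pre_id, NatTrans.id_app, SSet.mapπ₀_id_apply] using this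
  · have := congrFun (h K) x
    simpa only [MonoidalClosed.pre_map, NatTrans.comp_app, SSet.mapπ₀_comp_apply,
      MonoidalClosed.pre_id, NatTrans.id_app, SSet.mapπ₀_id_apply] using this

lemma IsWeakEquiv.comp {X Y Z : SSet.{u}} {f : X ⟶ Y} {g : Y ⟶ Z} (hf : IsWeakEquiv f)
    (hg : IsWeakEquiv g) : IsWeakEquiv (f ≫ g) := by
  intro K _
  have : SSet.mapπ₀ ((MonoidalClosed.pre (f ≫ g)).app K) =
      SSet.mapπ₀ ((MonoidalClosed.pre f).app K) ∘ SSet.mapπ₀ ((MonoidalClosed.pre g).app K) := by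
    funext x
    simp only [MonoidalClosed.pre_map, NatTrans.comp_app, SSet.mapπ₀_comp_apply,
      Function.comp_apply]
  rw [this]
  exact (hf K).comp (hg K)

/-! ### Lifting paths in Kan complexes -/

/-- A simplex of `∂Δ[1]` misses one of the two vertices, so it has a single value, which can be read
off at `0`. -/
lemma eq_const_of_mem_boundary {n : SimplexCategoryᵒᵖ} {x : Δ[1].obj n}
    (hx : x ∈ (SSet.boundary.{u} 1).obj n) :
    x = SSet.stdSimplex.const 1 (SSet.stdSimplex.asOrderHom x 0) n := by
  induction n using Opposite.rec with | _ n
  induction n using SimplexCategory.rec with | _ n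
  obtain ⟨j, hj⟩ := (SSet.mem_boundary_iff_notMem_range x).1 hx
  refine SSet.stdSimplex.ext _ _ fun i ↦ ?_
  have h₀ : x 0 ≠ j := fun h ↦ hj ⟨0, h⟩
  have h₁ : x i ≠ j := fun h ↦ hj ⟨i, h⟩
  change x i = x 0
  omega

lemma mem_horn_one (i : Fin 2) {n : SimplexCategoryᵒᵖ} (x : Δ[1].obj n) :
    x ∈ (SSet.horn.{u} 1 i).obj n ↔ x = SSet.stdSimplex.const 1 i n := by
  induction n using Opposite.rec with | _ n
  induction n using SimplexCategory.rec with | _ n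
  rw [SSet.mem_horn_iff_notMem_range]
  constructor
  · rintro ⟨j, hj, hx⟩
    refine SSet.stdSimplex.ext _ _ fun k ↦ ?_
    have h₁ : x k ≠ j := fun h ↦ hx ⟨k, h⟩
    change x k = i
    omega
  · rintro rfl
    obtain ⟨j, hj⟩ := exists_ne i
    exact ⟨j, hj, fun ⟨k, hk⟩ ↦ hj hk.symm⟩

/-- The inclusion of the end of the cylinder is anodyne. -/
lemma anodyneExtensions_ι₁ (Z : SSet.{u}) : SSet.anodyneExtensions (SSet.ι₁ (X := Z)) := by
  -- The horn `Λ[1, 1]` is the vertex `1` alone, so the product of `Z` with the horn inclusion is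
  -- `ι₁` up to isomorphism.
  have h := (SSet.anodyneExtensions.horn_ι.{u} (1 : Fin 2)).whiskerLeft Z
  let v : (Λ[1, 1] : SSet.{u}) _⦋0⦌ := ⟨SSet.stdSimplex.const 1 1 _, (mem_horn_one _ _).2 rfl⟩
  have hv (n : SimplexCategoryᵒᵖ) (x : (Λ[1, 1] : SSet.{u}).obj n) : (SSet.const v).app n x = x :=
    Subtype.ext ((mem_horn_one _ _).1 x.2).symm
  let e : Z ⊗ (Λ[1, 1] : SSet.{u}) ≅ Z :=
    { hom := fst _ _
      inv := CartesianMonoidalCategory.lift (𝟙 _) (SSet.const v)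
      hom_inv_id := by
        refine CartesianMonoidalCategory.hom_ext _ _ rfl ?_
        ext n ⟨z, x⟩
        exact hv n x
      inv_hom_id := rfl }
  refine (SSet.anodyneExtensions.arrow_mk_iso_iff (Arrow.isoMk e (Iso.refl _) ?_)).1 h
  refine CartesianMonoidalCategory.hom_ext _ _ rfl ?_
  ext n ⟨z, x⟩
  exact (congrArg Subtype.val (hv n x))

/-- The map out of the product with the boundary of the interval given by two maps. -/
def boundaryDesc {V X : SSet.{u}} (H : Fin 2 → (V ⟶ X)) : (∂Δ[1] : SSet.{u}) ⊗ V ⟶ X where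
  app n := ↾fun x ↦ (H (SSet.stdSimplex.asOrderHom x.1.1 0)).app n x.2
  naturality n m θ := by
    ext ⟨⟨b, hb⟩, v⟩
    have h : SSet.stdSimplex.asOrderHom (Δ[1].map θ b) 0 = SSet.stdSimplex.asOrderHom b 0 := by
      rw [eq_const_of_mem_boundary hb]
      rfl
    change (H (SSet.stdSimplex.asOrderHom (Δ[1].map θ b) 0)).app m (V.map θ v) = _
    rw [h]
    exact NatTrans.naturality_apply (H _) θ v

/-- As `∂Δ[1]` consists of two points, the two conditions on endpoints amount to one commutative
square, the lifting problem of `exists_path_lift`. -/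
lemma curry_boundaryDesc_comm {U V X : SSet.{u}} {i : U ⟶ V} (G : U ⟶ (ihom Δ[1]).obj X)
    (H : Fin 2 → (V ⟶ X)) (h : ∀ k, i ≫ H k = G ≫ endpoint X k) :
    G ≫ (MonoidalClosed.pre (SSet.boundary.{u} 1).ι).app X =
      i ≫ MonoidalClosed.curry (boundaryDesc H) := by
  apply MonoidalClosed.uncurry_injective
  rw [MonoidalClosed.uncurry_pre_app]
  ext d ⟨⟨b, hb⟩, u⟩
  obtain ⟨k, rfl⟩ : ∃ k, b = SSet.stdSimplex.const 1 k d := ⟨_, eq_const_of_mem_boundary hb⟩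
  have h₁ : (H k).app d (i.app d u) = (endpoint X k).app d (G.app d u) :=
    ConcreteCategory.congr_hom (NatTrans.congr_app (h k) d) u
  refine h₁.symm.trans ?_
  change _ = (H k).app d (V.map (𝟙 d) (i.app d u))
  simp

-- For a Kan complex `X`, restriction `X ^ Δ[1] ⟶ X ^ ∂Δ[1]` is a Kan fibration. With `i = ι₁` this
-- drags a path along while its two ends follow prescribed homotopies, which is how the Kan
-- condition enters all the deformations below.
open SSet.modelCategoryQuillen in
lemma exists_path_lift {U V X : SSet.{u}} [SSet.KanComplex X] {i : U ⟶ V}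
    (hi : SSet.anodyneExtensions i) (G : U ⟶ (ihom Δ[1]).obj X) (H : Fin 2 → (V ⟶ X))
    (h : ∀ k, i ≫ H k = G ≫ endpoint X k) :
    ∃ L : V ⟶ (ihom Δ[1]).obj X, i ≫ L = G ∧ ∀ k, L ≫ endpoint X k = H k := by
  have sq : CommSq G i ((MonoidalClosed.pre (SSet.boundary.{u} 1).ι).app X)
      (MonoidalClosed.curry (boundaryDesc H)) := ⟨curry_boundaryDesc_comm G H h⟩
  have hf : HomotopicalAlgebra.Fibration
      ((MonoidalClosed.pre (∂Δ[1] : SSet.Subcomplex.{u} _).ι).app X) :=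
    inferInstance
  have := hi _ hf.mem
  refine ⟨sq.lift, sq.fac_left, fun k ↦ ?_⟩
  have hk (n : SimplexCategoryᵒᵖ) :
      SSet.stdSimplex.const 1 k n ∈ (SSet.boundary.{u} 1).obj n := by
    induction n using Opposite.rec with | _ n
    induction n using SimplexCategory.rec with | _ n
    obtain ⟨j, hj⟩ := exists_ne k
    exact (SSet.mem_boundary_iff_notMem_range _).2 ⟨j, fun ⟨_, h⟩ ↦ hj h.symm⟩
  have h₁ := congrArg MonoidalClosed.uncurry sq.fac_right
  rw [MonoidalClosed.uncurry_curry, MonoidalClosed.uncurry_pre_app] at h₁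
  ext n v
  have h₂ := congr_app_pair h₁ (⟨_, hk n⟩ : (∂Δ[1] : SSet.{u}).obj n) v
  exact h₂

open HomotopicalAlgebra SSet.modelCategoryQuillen in
lemma exists_extension {U V X : SSet.{u}} [SSet.KanComplex X] {i : U ⟶ V}
    (hi : SSet.anodyneExtensions i) (p : U ⟶ X) : ∃ q : V ⟶ X, i ≫ q = p := by
  have sq : CommSq p i (Limits.terminal.from X) (Limits.terminal.from V) :=
    ⟨Limits.terminal.hom_ext _ _⟩
  have hX : SSet.KanComplex X := inferInstance
  have := hi _ ((isFibrant_iff X).1 hX).mem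
  exact ⟨sq.lift, sq.fac_left⟩

open HomotopicalAlgebra SSet.modelCategoryQuillen in
lemma kanComplex_of_exists_extension {X : SSet.{u}}
    (h : ∀ {U V : SSet.{u}} {i : U ⟶ V} (_ : SSet.anodyneExtensions i) (p : U ⟶ X),
      ∃ q : V ⟶ X, i ≫ q = p) : SSet.KanComplex X := by
  refine (isFibrant_iff _).2 ⟨?_⟩
  rw [fibrations_eq]
  intro U V i hi
  refine ⟨fun {t _} _ ↦ ?_⟩
  obtain ⟨q, hq⟩ := h (i := i) (fun _ _ p hp ↦ hp i hi) t
  exact ⟨⟨{ l := q, fac_left := hq, fac_right := Limits.terminal.hom_ext _ _ }⟩⟩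

/-- The two end components are extended first, then the path with these ends. This makes `Λ B` a Kan
complex, as the base change over `Λ B` in `isWeakEquiv_incidence` requires. -/
lemma HPullback.kanComplex {A B C : SSet.{u}} (f : A ⟶ C) (g : B ⟶ C) [SSet.KanComplex A]
    [SSet.KanComplex B] [SSet.KanComplex C] : SSet.KanComplex (HPullback f g) := by
  refine kanComplex_of_exists_extension fun {U V i} hi p ↦ ?_
  obtain ⟨a, ha⟩ := exists_extension hi (p ≫ fst f g)
  obtain ⟨b, hb⟩ := exists_extension hi (p ≫ snd f g)
  obtain ⟨L, hL, hL'⟩ := exists_path_lift hi (p ≫ path f g) ![a ≫ f, b ≫ g] (by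
    rw [Fin.forall_fin_two]
    constructor
    · simp [reassoc_of% ha, path_zero]
    · simp [reassoc_of% hb, path_one])
  refine ⟨lift a L b (hL' 0) (hL' 1), ?_⟩
  apply HPullback.hom_ext
  · simpa
  · simpa
  · simpa

instance {X Y : SSet.{u}} [SSet.KanComplex X] [SSet.KanComplex Y] : SSet.KanComplex (X ⊗ Y) := by
  refine kanComplex_of_exists_extension fun {U V i} hi p ↦ ?_
  obtain ⟨a, ha⟩ := exists_extension hi (p ≫ fst _ _)
  obtain ⟨b, hb⟩ := exists_extension hi (p ≫ snd _ _)
  refine ⟨CartesianMonoidalCategory.lift a b, ?_⟩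
  apply CartesianMonoidalCategory.hom_ext
  · simpa
  · simpa

instance {X : SSet.{u}} [SSet.KanComplex X] : SSet.KanComplex (freeLoop.obj X) :=
  HPullback.kanComplex (diag X) (diag X)

/-! ### Operations on paths -/

lemma curry_endpoint {X Y : SSet.{u}} (g : Δ[1] ⊗ Y ⟶ X) (i : Fin 2) :
    MonoidalClosed.curry g ≫ endpoint X i =
      CartesianMonoidalCategory.lift (SSet.const (SSet.stdSimplex.obj₀Equiv.symm i)) (𝟙 _) ≫ g := by
  exact congrArg (fun k ↦ CartesianMonoidalCategory.lift
    (SSet.const (SSet.stdSimplex.obj₀Equiv.symm i)) (𝟙 Y) ≫ k)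
    (MonoidalClosed.whiskerLeft_curry_ihom_ev_app _ _ g)

/-- The minimum of monotone maps. -/
def infMap (n : SimplexCategory) :
    SSet.stdSimplex.{u}.obj n ⊗ SSet.stdSimplex.obj n ⟶ SSet.stdSimplex.obj n where
  app _ := ↾fun x ↦ SSet.stdSimplex.objEquiv.symm (SimplexCategory.Hom.mk
    ((SSet.stdSimplex.objEquiv x.1).toOrderHom ⊓ (SSet.stdSimplex.objEquiv x.2).toOrderHom))
  naturality _ _ _ := rfl

/-- The maximum of monotone maps. -/
def supMap (n : SimplexCategory) :
    SSet.stdSimplex.{u}.obj n ⊗ SSet.stdSimplex.obj n ⟶ SSet.stdSimplex.obj n where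
  app _ := ↾fun x ↦ SSet.stdSimplex.objEquiv.symm (SimplexCategory.Hom.mk
    ((SSet.stdSimplex.objEquiv x.1).toOrderHom ⊔ (SSet.stdSimplex.objEquiv x.2).toOrderHom))
  naturality _ _ _ := rfl

section

variable {d : SimplexCategoryᵒᵖ} (t : Δ[1].obj d)

lemma stdSimplex_ext {n : SimplexCategory} {x y : (SSet.stdSimplex.{u}.obj n).obj d}
    (h : ∀ i, (SSet.stdSimplex.objEquiv x).toOrderHom i =
      (SSet.stdSimplex.objEquiv y).toOrderHom i) : x = y :=
  SSet.stdSimplex.objEquiv.injective (SimplexCategory.Hom.ext _ _ (OrderHom.ext _ _ (funext h)))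

lemma infMap_const_one : (infMap ⦋1⦌).app d (t, SSet.stdSimplex.const 1 1 d) = t :=
  stdSimplex_ext fun i ↦
    min_eq_left (Fin.le_last (n := 1) ((SSet.stdSimplex.objEquiv t).toOrderHom i))

lemma infMap_const_zero :
    (infMap ⦋1⦌).app d (t, SSet.stdSimplex.const 1 0 d) = SSet.stdSimplex.const 1 0 d :=
  stdSimplex_ext fun i ↦
    min_eq_right (Fin.zero_le (n := 2) ((SSet.stdSimplex.objEquiv t).toOrderHom i))

lemma infMap_one_const : (infMap ⦋1⦌).app d (SSet.stdSimplex.const 1 1 d, t) = t :=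
  stdSimplex_ext fun i ↦
    min_eq_right (Fin.le_last (n := 1) ((SSet.stdSimplex.objEquiv t).toOrderHom i))

lemma infMap_zero_const :
    (infMap ⦋1⦌).app d (SSet.stdSimplex.const 1 0 d, t) = SSet.stdSimplex.const 1 0 d :=
  stdSimplex_ext fun i ↦
    min_eq_left (Fin.zero_le (n := 2) ((SSet.stdSimplex.objEquiv t).toOrderHom i))

lemma supMap_const_one :
    (supMap ⦋1⦌).app d (t, SSet.stdSimplex.const 1 1 d) = SSet.stdSimplex.const 1 1 d :=
  stdSimplex_ext fun i ↦
    max_eq_right (Fin.le_last (n := 1) ((SSet.stdSimplex.objEquiv t).toOrderHom i))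

lemma supMap_const_zero : (supMap ⦋1⦌).app d (t, SSet.stdSimplex.const 1 0 d) = t :=
  stdSimplex_ext fun i ↦
    max_eq_left (Fin.zero_le (n := 2) ((SSet.stdSimplex.objEquiv t).toOrderHom i))

lemma supMap_one_const :
    (supMap ⦋1⦌).app d (SSet.stdSimplex.const 1 1 d, t) = SSet.stdSimplex.const 1 1 d :=
  stdSimplex_ext fun i ↦
    max_eq_left (Fin.le_last (n := 1) ((SSet.stdSimplex.objEquiv t).toOrderHom i))

lemma supMap_zero_const : (supMap ⦋1⦌).app d (SSet.stdSimplex.const 1 0 d, t) = t :=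
  stdSimplex_ext fun i ↦
    max_eq_right (Fin.zero_le (n := 2) ((SSet.stdSimplex.objEquiv t).toOrderHom i))

end

/-- Constant paths. -/
def constPath (X : SSet.{u}) : X ⟶ (ihom Δ[1]).obj X := MonoidalClosed.curry (snd _ _)

lemma constPath_endpoint (X : SSet.{u}) (i : Fin 2) : constPath X ≫ endpoint X i = 𝟙 X := by
  rw [constPath, curry_endpoint, CartesianMonoidalCategory.lift_snd]

lemma constPath_naturality {X Y : SSet.{u}} (f : X ⟶ Y) :
    constPath X ≫ (ihom Δ[1]).map f = f ≫ constPath Y := by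
  rw [constPath, constPath, ← MonoidalClosed.curry_natural_right,
    ← MonoidalClosed.curry_natural_left]
  rfl

/-- The evaluation of a path at a parameter. -/
def evalPath (X : SSet.{u}) : (ihom Δ[1]).obj X ⊗ Δ[1] ⟶ X :=
  (β_ _ _).hom ≫ (ihom.ev Δ[1]).app X

lemma evalPath_naturality {X Y : SSet.{u}} (f : X ⟶ Y) :
    (ihom Δ[1]).map f ▷ Δ[1] ≫ evalPath Y = evalPath X ≫ f := rfl

lemma ι₀_evalPath (X : SSet.{u}) : SSet.ι₀ ≫ evalPath X = endpoint X 0 := rfl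

lemma ι₁_evalPath (X : SSet.{u}) : SSet.ι₁ ≫ evalPath X = endpoint X 1 := rfl

lemma constPath_evalPath (X : SSet.{u}) : constPath X ▷ Δ[1] ≫ evalPath X = fst _ _ := by
  have h := MonoidalClosed.whiskerLeft_curry_ihom_ev_app Δ[1] _ (snd Δ[1] X)
  change (β_ _ _).hom ≫ Δ[1] ◁ constPath X ≫ (ihom.ev Δ[1]).app X = (β_ _ _).hom ≫ snd _ _
  exact congrArg (fun k ↦ (β_ X Δ[1]).hom ≫ k) h

/-- Reparametrization of paths by an operation on the interval. -/
def reparam (m : (Δ[1] : SSet.{u}) ⊗ Δ[1] ⟶ Δ[1]) (X : SSet.{u}) :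
    (ihom Δ[1]).obj X ⊗ Δ[1] ⟶ (ihom Δ[1]).obj X :=
  MonoidalClosed.curry (CartesianMonoidalCategory.lift
    (CartesianMonoidalCategory.lift (fst _ _) (snd _ _ ≫ snd _ _) ≫ m)
      (snd _ _ ≫ fst _ _) ≫ (ihom.ev Δ[1]).app X)

lemma reparam_naturality (m : (Δ[1] : SSet.{u}) ⊗ Δ[1] ⟶ Δ[1]) {X Y : SSet.{u}} (f : X ⟶ Y) :
    (ihom Δ[1]).map f ▷ Δ[1] ≫ reparam m Y = reparam m X ≫ (ihom Δ[1]).map f := by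
  rw [reparam, reparam, ← MonoidalClosed.curry_natural_right, ← MonoidalClosed.curry_natural_left]
  rfl

/-- The path `t ↦ h (min t s)`. -/
def initialPath (X : SSet.{u}) : (ihom Δ[1]).obj X ⊗ Δ[1] ⟶ (ihom Δ[1]).obj X :=
  reparam (infMap ⦋1⦌) X

/-- The path `t ↦ h (max t s)`. -/
def finalPath (X : SSet.{u}) : (ihom Δ[1]).obj X ⊗ Δ[1] ⟶ (ihom Δ[1]).obj X :=
  reparam (supMap ⦋1⦌) X

/-- In `m (t, s)` the slot `t` is the parameter of the new path and `s` that of the homotopy.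
Freezing `s` computes the ends of the homotopy; freezing `t`, as in `reparam_endpoint_eq_evalPath`,
computes the ends of the paths. -/
lemma comp_reparam_eq_id (m : (Δ[1] : SSet.{u}) ⊗ Δ[1] ⟶ Δ[1]) (X : SSet.{u}) {i : Fin 2}
    (hm : ∀ (d : SimplexCategoryᵒᵖ) (t : Δ[1].obj d),
      m.app d (t, SSet.stdSimplex.const 1 i d) = t) :
    CartesianMonoidalCategory.lift (𝟙 _) (SSet.const (SSet.stdSimplex.obj₀Equiv.symm i)) ≫
      reparam m X = 𝟙 _ := by
  rw [reparam, ← MonoidalClosed.curry_natural_left]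
  apply MonoidalClosed.uncurry_injective
  rw [MonoidalClosed.uncurry_curry, MonoidalClosed.uncurry_id_eq_ev]
  ext d ⟨t, h⟩
  change ((ihom.ev Δ[1]).app X).app d (m.app d (t, SSet.stdSimplex.const 1 i d), h) = _
  rw [hm]
  rfl

lemma comp_reparam_eq_const (m : (Δ[1] : SSet.{u}) ⊗ Δ[1] ⟶ Δ[1]) (X : SSet.{u}) {i k : Fin 2}
    (hm : ∀ (d : SimplexCategoryᵒᵖ) (t : Δ[1].obj d),
      m.app d (t, SSet.stdSimplex.const 1 i d) = SSet.stdSimplex.const 1 k d) :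
    CartesianMonoidalCategory.lift (𝟙 _) (SSet.const (SSet.stdSimplex.obj₀Equiv.symm i)) ≫
      reparam m X = endpoint X k ≫ constPath X := by
  rw [reparam, ← MonoidalClosed.curry_natural_left, constPath, ← MonoidalClosed.curry_natural_left]
  apply MonoidalClosed.uncurry_injective
  rw [MonoidalClosed.uncurry_curry, MonoidalClosed.uncurry_curry]
  ext d ⟨t, h⟩
  change ((ihom.ev Δ[1]).app X).app d (m.app d (t, SSet.stdSimplex.const 1 i d), h) = _
  rw [hm]
  rfl

lemma reparam_endpoint_eq_evalPath (m : (Δ[1] : SSet.{u}) ⊗ Δ[1] ⟶ Δ[1]) (X : SSet.{u}) {i : Fin 2}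
    (hm : ∀ (d : SimplexCategoryᵒᵖ) (t : Δ[1].obj d),
      m.app d (SSet.stdSimplex.const 1 i d, t) = t) :
    reparam m X ≫ endpoint X i = evalPath X := by
  rw [reparam, curry_endpoint]
  ext d ⟨h, t⟩
  change ((ihom.ev Δ[1]).app X).app d (m.app d (SSet.stdSimplex.const 1 i d, t), h) = _
  rw [hm]
  rfl

lemma reparam_endpoint_eq_endpoint (m : (Δ[1] : SSet.{u}) ⊗ Δ[1] ⟶ Δ[1]) (X : SSet.{u})
    {i k : Fin 2} (hm : ∀ (d : SimplexCategoryᵒᵖ) (t : Δ[1].obj d),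
      m.app d (SSet.stdSimplex.const 1 i d, t) = SSet.stdSimplex.const 1 k d) :
    reparam m X ≫ endpoint X i = fst _ _ ≫ endpoint X k := by
  rw [reparam, curry_endpoint]
  ext d ⟨h, t⟩
  change ((ihom.ev Δ[1]).app X).app d (m.app d (SSet.stdSimplex.const 1 i d, t), h) = _
  rw [hm]
  rfl

lemma constPath_reparam (m : (Δ[1] : SSet.{u}) ⊗ Δ[1] ⟶ Δ[1]) (X : SSet.{u}) :
    constPath X ▷ Δ[1] ≫ reparam m X = fst _ _ ≫ constPath X := by
  rw [reparam, ← MonoidalClosed.curry_natural_left]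
  conv_rhs => rw [constPath, ← MonoidalClosed.curry_natural_left]
  have h := MonoidalClosed.whiskerLeft_curry_ihom_ev_app Δ[1] _ (snd Δ[1] X)
  congr 1
  exact congrArg (fun k ↦ CartesianMonoidalCategory.lift
    (CartesianMonoidalCategory.lift (fst _ _) (snd _ _ ≫ snd _ _) ≫ m)
      (snd Δ[1] (X ⊗ Δ[1]) ≫ fst _ _) ≫ k) h

lemma ι₀_initialPath (X : SSet.{u}) :
    SSet.ι₀ ≫ initialPath X = endpoint X 0 ≫ constPath X :=
  comp_reparam_eq_const _ _ fun _ _ ↦ infMap_const_zero _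

lemma ι₁_initialPath (X : SSet.{u}) : SSet.ι₁ ≫ initialPath X = 𝟙 _ :=
  comp_reparam_eq_id _ _ fun _ _ ↦ infMap_const_one _

lemma initialPath_endpoint_zero (X : SSet.{u}) :
    initialPath X ≫ endpoint X 0 = fst _ _ ≫ endpoint X 0 :=
  reparam_endpoint_eq_endpoint _ _ fun _ _ ↦ infMap_zero_const _

lemma initialPath_endpoint_one (X : SSet.{u}) : initialPath X ≫ endpoint X 1 = evalPath X :=
  reparam_endpoint_eq_evalPath _ _ fun _ _ ↦ infMap_one_const _

lemma ι₀_finalPath (X : SSet.{u}) : SSet.ι₀ ≫ finalPath X = 𝟙 _ :=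
  comp_reparam_eq_id _ _ fun _ _ ↦ supMap_const_zero _

lemma ι₁_finalPath (X : SSet.{u}) :
    SSet.ι₁ ≫ finalPath X = endpoint X 1 ≫ constPath X :=
  comp_reparam_eq_const _ _ fun _ _ ↦ supMap_const_one _

lemma finalPath_endpoint_zero (X : SSet.{u}) : finalPath X ≫ endpoint X 0 = evalPath X :=
  reparam_endpoint_eq_evalPath _ _ fun _ _ ↦ supMap_zero_const _

lemma finalPath_endpoint_one (X : SSet.{u}) :
    finalPath X ≫ endpoint X 1 = fst _ _ ≫ endpoint X 1 :=
  reparam_endpoint_eq_endpoint _ _ fun _ _ ↦ supMap_one_const _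

/-! ### Deformation retracts -/

namespace HPullback

section

variable {A B C Z W : SSet.{u}} {f : A ⟶ C} {g : B ⟶ C} (p : Z ⟶ A) (h : Z ⟶ (ihom Δ[1]).obj C)
  (q : Z ⟶ B) (h₀ : h ≫ endpoint C 0 = p ≫ f) (h₁ : h ≫ endpoint C 1 = q ≫ g)

@[simp]
lemma lift_fst_assoc (k : A ⟶ W) : lift p h q h₀ h₁ ≫ fst f g ≫ k = p ≫ k := rfl

@[simp]
lemma lift_path_assoc (k : (ihom Δ[1]).obj C ⟶ W) : lift p h q h₀ h₁ ≫ path f g ≫ k = h ≫ k := rfl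

@[simp]
lemma lift_snd_assoc (k : B ⟶ W) : lift p h q h₀ h₁ ≫ snd f g ≫ k = q ≫ k := rfl

end

end HPullback

/-- A map `j : A ⟶ X` is the inclusion of a deformation retract if `X` can be deformed into `A` by a
homotopy which preserves `A`. -/
structure DeformationRetract {A X : SSet.{u}} (j : A ⟶ X) where
  mono : Mono j
  /-- the deformation -/
  h : X ⊗ Δ[1] ⟶ X
  /-- the retraction -/
  r : X ⟶ A
  /-- the restriction of the deformation -/
  h' : A ⊗ Δ[1] ⟶ A
  ι₁_h : SSet.ι₁ ≫ h = 𝟙 X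
  ι₀_h : SSet.ι₀ ≫ h = r ≫ j
  comm : j ▷ Δ[1] ≫ h = h' ≫ j

namespace DeformationRetract

variable {A X : SSet.{u}} {j : A ⟶ X}

/-- The deformation may move points inside `A`, so `r` need not be a strict retraction. Since `j` is
mono, the ends of `h'` can be computed after `j`, and `h'` joins `j ≫ r` to the identity. -/
lemma isWeakEquiv (d : DeformationRetract j) : IsWeakEquiv j := by
  have := d.mono
  refine isWeakEquiv_of_weakHomotopic _ d.r (.of_homotopy d.h' ?_ ?_)
    (.of_homotopy d.h d.ι₀_h d.ι₁_h)
  · rw [← cancel_mono j, Category.assoc, ← d.comm, Category.assoc, ← d.ι₀_h]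
    rfl
  · rw [← cancel_mono j, Category.assoc, ← d.comm, SSet.ι₁_comp_assoc, d.ι₁_h]
    rfl

/-- The base change of a map along the path fibration. -/
def baseChange (j : A ⟶ X) {Y : SSet.{u}} (g : Y ⟶ X) : HPullback j g ⟶ HPullback (𝟙 X) g :=
  HPullback.lift (HPullback.fst j g ≫ j) (HPullback.path j g) (HPullback.snd j g)
    (HPullback.path_zero j g) (HPullback.path_one j g)

@[simp]
lemma baseChange_fst {Y : SSet.{u}} (g : Y ⟶ X) :
    baseChange j g ≫ HPullback.fst (𝟙 X) g = HPullback.fst j g ≫ j := rfl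

@[simp]
lemma baseChange_path {Y : SSet.{u}} (g : Y ⟶ X) :
    baseChange j g ≫ HPullback.path (𝟙 X) g = HPullback.path j g := rfl

@[simp]
lemma baseChange_snd {Y : SSet.{u}} (g : Y ⟶ X) :
    baseChange j g ≫ HPullback.snd (𝟙 X) g = HPullback.snd j g := rfl

instance [Mono j] {Y : SSet.{u}} (g : Y ⟶ X) : Mono (baseChange j g) := by
  refine ⟨fun p q h ↦ HPullback.hom_ext ?_ ?_ ?_⟩
  · rw [← cancel_mono j, Category.assoc, Category.assoc, ← baseChange_fst, reassoc_of% h]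
  · rw [← baseChange_path, reassoc_of% h]
  · rw [← baseChange_snd, reassoc_of% h]

/-- The base change of a deformation retract along the path fibration. -/
lemma nonempty_baseChange [SSet.KanComplex X] (d : DeformationRetract j) {Y : SSet.{u}}
    (g : Y ⟶ X) : Nonempty (DeformationRetract (baseChange j g)) := by
  have := d.mono
  -- For a path from `x` to `g y`, the point `x` moves along `d.h` while `g y` stays fixed. The path
  -- is known at time `1`, where `d.h` is the identity, and is extended to all times.
  obtain ⟨L, hL, hL'⟩ := exists_path_lift (anodyneExtensions_ι₁ (HPullback (𝟙 X) g))
    (HPullback.path (𝟙 X) g)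
    ![(HPullback.fst (𝟙 X) g ▷ Δ[1] ≫ d.h) ≫ 𝟙 X, (fst _ _ ≫ HPullback.snd (𝟙 X) g) ≫ g] (by
      rw [Fin.forall_fin_two]
      constructor
      · simp [HPullback.path_zero, d.ι₁_h]
      · simp [HPullback.path_one])
  have hL₀ : L ≫ endpoint X 0 = (HPullback.fst (𝟙 X) g ▷ Δ[1] ≫ d.h) ≫ 𝟙 X := hL' 0
  have hL₁ : L ≫ endpoint X 1 = (fst _ _ ≫ HPullback.snd (𝟙 X) g) ≫ g := hL' 1
  have e : baseChange j g ▷ Δ[1] ≫ HPullback.fst (𝟙 X) g ▷ Δ[1] =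
      HPullback.fst j g ▷ Δ[1] ≫ j ▷ Δ[1] := by
    rw [← comp_whiskerRight, baseChange_fst, comp_whiskerRight]
  refine ⟨{
    mono := inferInstance
    h := HPullback.lift (HPullback.fst (𝟙 X) g ▷ Δ[1] ≫ d.h) L
      (fst _ _ ≫ HPullback.snd (𝟙 X) g) hL₀ hL₁
    r := HPullback.lift (HPullback.fst (𝟙 X) g ≫ d.r) (SSet.ι₀ ≫ L) (HPullback.snd (𝟙 X) g)
      (by simp [hL₀, d.ι₀_h]) (by simp [hL₁])
    -- Membership in the sub-object concerns only the starting point, which `d.h` keeps in `A`; the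
    -- choice of `L` does not matter.
    h' := HPullback.lift (HPullback.fst j g ▷ Δ[1] ≫ d.h')
      (baseChange j g ▷ Δ[1] ≫ L) (fst _ _ ≫ HPullback.snd j g)
      (by simp [hL₀, reassoc_of% e, d.comm])
      (by simp [hL₁, reassoc_of% baseChange_snd (j := j) g])
    ι₁_h := ?_
    ι₀_h := ?_
    comm := ?_ }⟩
  · apply HPullback.hom_ext
    · simp [d.ι₁_h]
    · simp [hL]
    · simp
  · apply HPullback.hom_ext
    · simp [d.ι₀_h]
    · simp
    · simp
  · apply HPullback.hom_ext
    · simp [reassoc_of% e, d.comm]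
    · simp
    · simp

end DeformationRetract

/-- The map which sends a point `y` to the constant path at `g y`. -/
def pathSection {X Y : SSet.{u}} (g : Y ⟶ X) : Y ⟶ HPullback (𝟙 X) g :=
  HPullback.lift g (g ≫ constPath X) (𝟙 Y) (by simp [constPath_endpoint])
    (by simp [constPath_endpoint])

/-- The homotopy which shrinks a path from `x` to `g y` to the constant path at `g y`. -/
def pathContraction {X Y : SSet.{u}} (g : Y ⟶ X) :
    HPullback (𝟙 X) g ⊗ Δ[1] ⟶ HPullback (𝟙 X) g :=
  HPullback.lift (HPullback.path _ _ ▷ Δ[1] ≫ evalPath X) (HPullback.path _ _ ▷ Δ[1] ≫ finalPath X)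
    (fst _ _ ≫ HPullback.snd (𝟙 X) g) (by simp [finalPath_endpoint_zero])
    (by simp [finalPath_endpoint_one, HPullback.path_one])

@[simp]
lemma pathSection_snd {X Y : SSet.{u}} (g : Y ⟶ X) :
    pathSection g ≫ HPullback.snd (𝟙 X) g = 𝟙 Y := rfl

lemma ι₀_pathContraction {X Y : SSet.{u}} (g : Y ⟶ X) :
    SSet.ι₀ ≫ pathContraction g = 𝟙 _ := by
  apply HPullback.hom_ext
  · simp [pathContraction, ι₀_evalPath, HPullback.path_zero]
  · simp [pathContraction, ι₀_finalPath]
  · simp [pathContraction]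

lemma ι₁_pathContraction {X Y : SSet.{u}} (g : Y ⟶ X) :
    SSet.ι₁ ≫ pathContraction g = HPullback.snd (𝟙 X) g ≫ pathSection g := by
  apply HPullback.hom_ext
  · simp [pathContraction, pathSection, ι₁_evalPath, HPullback.path_one]
  · simp [pathContraction, pathSection, ι₁_finalPath, reassoc_of% HPullback.path_one (𝟙 X) g]
  · simp [pathContraction, pathSection]

lemma isWeakEquiv_snd_id {X Y : SSet.{u}} (g : Y ⟶ X) : IsWeakEquiv (HPullback.snd (𝟙 X) g) :=
  isWeakEquiv_of_weakHomotopic _ (pathSection g)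
    (WeakHomotopic.of_homotopy _ (ι₀_pathContraction g) (ι₁_pathContraction g)).symm
    (by rw [pathSection_snd]; exact .refl _)

/-- The homotopy pullback of the inclusion of a deformation retract is a weak equivalence. -/
lemma DeformationRetract.isWeakEquiv_snd {A X Y : SSet.{u}} [SSet.KanComplex X] {j : A ⟶ X}
    (d : DeformationRetract j) (g : Y ⟶ X) : IsWeakEquiv (HPullback.snd j g) := by
  obtain ⟨d'⟩ := d.nonempty_baseChange g
  rw [← baseChange_snd]
  exact d'.isWeakEquiv.comp (isWeakEquiv_snd_id g)

/-! ### The fibres of an iterated pullback -/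

/-- For `γ : C ⟶ D` and `i : D ⟶ X`, the comparison map from the homotopy pullback of `γ ≫ i` to the
iterated homotopy pullback. -/
def iteratedLift {C D X Y : SSet.{u}} (γ : C ⟶ D) (i : D ⟶ X) (g : Y ⟶ X) :
    HPullback (γ ≫ i) g ⟶ HPullback γ (HPullback.fst i g) :=
  HPullback.lift (HPullback.fst _ _) (HPullback.fst _ _ ≫ γ ≫ constPath D)
    (HPullback.lift (HPullback.fst _ _ ≫ γ) (HPullback.path _ _) (HPullback.snd _ _)
      (HPullback.path_zero _ _) (HPullback.path_one _ _))
    (by simp [constPath_endpoint]) (by rw [Category.assoc, Category.assoc, constPath_endpoint]; rfl)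

section

variable {C D X Y : SSet.{u}} (γ : C ⟶ D) (i : D ⟶ X) (g : Y ⟶ X)

lemma iteratedLift_fst : iteratedLift γ i g ≫ HPullback.fst γ (HPullback.fst i g) =
    HPullback.fst (γ ≫ i) g := rfl

lemma iteratedLift_path : iteratedLift γ i g ≫ HPullback.path γ (HPullback.fst i g) =
    HPullback.fst (γ ≫ i) g ≫ γ ≫ constPath D := rfl

lemma iteratedLift_snd_fst :
    iteratedLift γ i g ≫ HPullback.snd γ (HPullback.fst i g) ≫ HPullback.fst i g =
      HPullback.fst (γ ≫ i) g ≫ γ := rfl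

lemma iteratedLift_snd_path :
    iteratedLift γ i g ≫ HPullback.snd γ (HPullback.fst i g) ≫ HPullback.path i g =
      HPullback.path (γ ≫ i) g := rfl

lemma iteratedLift_snd_snd :
    iteratedLift γ i g ≫ HPullback.snd γ (HPullback.fst i g) ≫ HPullback.snd i g =
      HPullback.snd (γ ≫ i) g := rfl

lemma iterated_hom_ext {Z : SSet.{u}} {a b : Z ⟶ HPullback γ (HPullback.fst i g)}
    (h₁ : a ≫ HPullback.fst γ (HPullback.fst i g) = b ≫ HPullback.fst γ (HPullback.fst i g))
    (h₂ : a ≫ HPullback.path γ (HPullback.fst i g) = b ≫ HPullback.path γ (HPullback.fst i g))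
    (h₃ : a ≫ HPullback.snd γ (HPullback.fst i g) ≫ HPullback.fst i g =
      b ≫ HPullback.snd γ (HPullback.fst i g) ≫ HPullback.fst i g)
    (h₄ : a ≫ HPullback.snd γ (HPullback.fst i g) ≫ HPullback.path i g =
      b ≫ HPullback.snd γ (HPullback.fst i g) ≫ HPullback.path i g)
    (h₅ : a ≫ HPullback.snd γ (HPullback.fst i g) ≫ HPullback.snd i g =
      b ≫ HPullback.snd γ (HPullback.fst i g) ≫ HPullback.snd i g) : a = b :=
  HPullback.hom_ext h₁ h₂ (HPullback.hom_ext (by simpa using h₃) (by simpa using h₄)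
    (by simpa using h₅))

instance : Mono (iteratedLift γ i g) := by
  refine ⟨fun a b h ↦ HPullback.hom_ext ?_ ?_ ?_⟩
  · rw [← iteratedLift_fst, reassoc_of% h]
  · rw [← iteratedLift_snd_path, reassoc_of% h]
  · rw [← iteratedLift_snd_snd, reassoc_of% h]

/-- A point consists of `c`, a path `p` in `D` from `γ c` to `d`, and a path in `X` from `i d` to `g
y`. At time `s` the point `d` is pulled back to `p s`, and the path in `X` is dragged to one from `i
(p s)` to `g y`. -/
lemma exists_iteratedPath [SSet.KanComplex X] :
    ∃ L : HPullback γ (HPullback.fst i g) ⊗ Δ[1] ⟶ (ihom Δ[1]).obj X,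
      SSet.ι₁ ≫ L = HPullback.snd γ (HPullback.fst i g) ≫ HPullback.path i g ∧
      L ≫ endpoint X 0 = (HPullback.path γ (HPullback.fst i g) ▷ Δ[1] ≫ evalPath D) ≫ i ∧
      L ≫ endpoint X 1 =
        (fst _ _ ≫ HPullback.snd γ (HPullback.fst i g) ≫ HPullback.snd i g) ≫ g := by
  obtain ⟨L, hL, hL'⟩ := exists_path_lift (anodyneExtensions_ι₁ (HPullback γ (HPullback.fst i g)))
    (HPullback.snd γ (HPullback.fst i g) ≫ HPullback.path i g)
    ![(HPullback.path γ (HPullback.fst i g) ▷ Δ[1] ≫ evalPath D) ≫ i,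
      (fst _ _ ≫ HPullback.snd γ (HPullback.fst i g) ≫ HPullback.snd i g) ≫ g] (by
      have hs := HPullback.path_one γ (HPullback.fst i g)
      rw [Fin.forall_fin_two]
      constructor
      · have h₀ := HPullback.path_zero i g
        simp [h₀, reassoc_of% ι₁_evalPath, ← reassoc_of% hs]
      · have h₁ := HPullback.path_one i g
        simp [h₁])
  exact ⟨L, hL, hL' 0, hL' 1⟩

/-- At time `s` only the part of `p` over `[0, s]` is kept. At time `0` it is constant at `γ c`, and
what remains is a point of the homotopy pullback of `γ ≫ i` and `g`. -/
lemma nonempty_deformationRetract_iteratedLift [SSet.KanComplex X] :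
    Nonempty (DeformationRetract (iteratedLift γ i g)) := by
  obtain ⟨L, hL, hL₀, hL₁⟩ := exists_iteratedPath γ i g
  have hs := HPullback.path_one γ (HPullback.fst i g)
  have hp := HPullback.path_zero γ (HPullback.fst i g)
  have e : iteratedLift γ i g ▷ Δ[1] ≫ HPullback.path γ (HPullback.fst i g) ▷ Δ[1] =
    HPullback.fst (γ ≫ i) g ▷ Δ[1] ≫ γ ▷ Δ[1] ≫ constPath D ▷ Δ[1] := by
    rw [← comp_whiskerRight, iteratedLift_path, comp_whiskerRight, comp_whiskerRight]
  refine ⟨{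
    mono := inferInstance
    h := HPullback.lift (fst _ _ ≫ HPullback.fst γ (HPullback.fst i g))
      (HPullback.path γ (HPullback.fst i g) ▷ Δ[1] ≫ initialPath D)
      (HPullback.lift (HPullback.path γ (HPullback.fst i g) ▷ Δ[1] ≫ evalPath D) L
        (fst _ _ ≫ HPullback.snd γ (HPullback.fst i g) ≫ HPullback.snd i g) hL₀ hL₁)
      (by simp [initialPath_endpoint_zero, hp]) (by simp [initialPath_endpoint_one])
    r := HPullback.lift (HPullback.fst γ (HPullback.fst i g)) (SSet.ι₀ ≫ L)
      (HPullback.snd γ (HPullback.fst i g) ≫ HPullback.snd i g)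
      (by simp [hL₀, reassoc_of% ι₀_evalPath, reassoc_of% hp]) (by simp [hL₁])
    h' := HPullback.lift (fst _ _ ≫ HPullback.fst (γ ≫ i) g) (iteratedLift γ i g ▷ Δ[1] ≫ L)
      (fst _ _ ≫ HPullback.snd (γ ≫ i) g)
      (by simp [hL₀, reassoc_of% e, reassoc_of% constPath_evalPath])
      (by simp [hL₁, reassoc_of% iteratedLift_snd_snd])
    ι₁_h := ?_
    ι₀_h := ?_
    comm := ?_ }⟩
  · apply iterated_hom_ext
    · simp
    · simp [ι₁_initialPath]
    · simp [ι₁_evalPath, hs]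
    · simp [hL]
    · simp
  · apply iterated_hom_ext
    · simp [iteratedLift_fst]
    · simp [iteratedLift_path, ι₀_initialPath, reassoc_of% hp]
    · simp [iteratedLift_snd_fst, ι₀_evalPath, hp]
    · simp [iteratedLift_snd_path]
    · simp [iteratedLift_snd_snd]
  · apply iterated_hom_ext
    · simp [iteratedLift_fst]
    · simp [iteratedLift_path, reassoc_of% e, initialPath, constPath_reparam]
    · simp [iteratedLift_snd_fst, reassoc_of% e, constPath_evalPath]
    · simp [iteratedLift_snd_path]
    · simp [iteratedLift_snd_snd]

lemma equivOver_fibre_iterated [SSet.KanComplex X] :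
    EquivOver (HPullback.snd (γ ≫ i) g)
      (HPullback.snd γ (HPullback.fst i g) ≫ HPullback.snd i g) := by
  obtain ⟨d⟩ := nonempty_deformationRetract_iteratedLift γ i g
  exact ⟨_, d.isWeakEquiv, homotopy_of_eq (iteratedLift_snd_snd γ i g).symm⟩

end

/-! ### Strict loops -/

/-- The paths in `X` whose two endpoints coincide. -/
def strictLoopSub (X : SSet.{u}) : ((ihom Δ[1]).obj X).Subcomplex where
  obj n := { h | (endpoint X 0).app n h = (endpoint X 1).app n h }
  map {n m} θ h hh := by
    change (endpoint X 0).app m (((ihom Δ[1]).obj X).map θ h) =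
      (endpoint X 1).app m (((ihom Δ[1]).obj X).map θ h)
    have hh' : (endpoint X 0).app n h = (endpoint X 1).app n h := hh
    rw [NatTrans.naturality_apply, NatTrans.naturality_apply, hh']

/-- The space of unbased loops in `X`. -/
def StrictLoop (X : SSet.{u}) : SSet.{u} := (strictLoopSub X).toSSet

namespace StrictLoop

variable (X : SSet.{u})

/-- The underlying path of a loop. -/
def path : StrictLoop X ⟶ (ihom Δ[1]).obj X := (strictLoopSub X).ι

instance : Mono (path X) := inferInstanceAs (Mono (strictLoopSub X).ι)

/-- The basepoint of a loop. -/
def proj : StrictLoop X ⟶ X := path X ≫ endpoint X 0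

lemma path_endpoint (i : Fin 2) : path X ≫ endpoint X i = proj X := by
  revert i
  rw [Fin.forall_fin_two]
  refine ⟨rfl, ?_⟩
  ext n h
  exact h.2.symm

variable {X}

/-- The map to the space of loops given by a path with equal endpoints. -/
def lift {Z : SSet.{u}} (h : Z ⟶ (ihom Δ[1]).obj X) (hh : h ≫ endpoint X 0 = h ≫ endpoint X 1) :
    Z ⟶ StrictLoop X :=
  SSet.Subcomplex.lift h (by
    rintro n _ ⟨z, rfl⟩
    exact ConcreteCategory.congr_hom (NatTrans.congr_app hh n) z)

@[simp]
lemma lift_path {Z : SSet.{u}} (h : Z ⟶ (ihom Δ[1]).obj X)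
    (hh : h ≫ endpoint X 0 = h ≫ endpoint X 1) : lift h hh ≫ path X = h := rfl

end StrictLoop

/-- A pair of paths gives a path in the product. -/
def pairPath (X Y : SSet.{u}) :
    (ihom Δ[1]).obj X ⊗ (ihom Δ[1]).obj Y ⟶ (ihom Δ[1]).obj (X ⊗ Y) :=
  MonoidalClosed.curry (CartesianMonoidalCategory.lift
    (Δ[1] ◁ fst _ _ ≫ (ihom.ev Δ[1]).app X) (Δ[1] ◁ snd _ _ ≫ (ihom.ev Δ[1]).app Y))

lemma pairPath_endpoint (X Y : SSet.{u}) (i : Fin 2) :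
    pairPath X Y ≫ endpoint (X ⊗ Y) i = endpoint X i ⊗ₘ endpoint Y i := by
  rw [pairPath, curry_endpoint]
  rfl

lemma lift_map_pairPath (X Y : SSet.{u}) :
    CartesianMonoidalCategory.lift ((ihom Δ[1]).map (fst X Y)) ((ihom Δ[1]).map (snd X Y)) ≫
      pairPath X Y = 𝟙 _ := by
  rw [pairPath, ← MonoidalClosed.curry_natural_left]
  apply MonoidalClosed.uncurry_injective
  rw [MonoidalClosed.uncurry_curry, MonoidalClosed.uncurry_id_eq_ev]
  rfl

lemma pathConst_map_fst (X : SSet.{u}) : pathConst X ≫ (ihom Δ[1]).map (fst X X) = 𝟙 _ := by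
  rw [pathConst, ← MonoidalClosed.curry_natural_right, CartesianMonoidalCategory.lift_fst]
  exact MonoidalClosed.curry_uncurry _

lemma pathConst_map_snd (X : SSet.{u}) :
    pathConst X ≫ (ihom Δ[1]).map (snd X X) = endpoint X 0 ≫ constPath X := by
  rw [pathConst, ← MonoidalClosed.curry_natural_right, CartesianMonoidalCategory.lift_snd,
    constPath, ← MonoidalClosed.curry_natural_left]
  rfl

section

variable (X : SSet.{u})

/-- The first path of a pair of parallel paths. -/
def freeLoopFst : HPullback (diag X) (diag X) ⟶ (ihom Δ[1]).obj X :=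
  HPullback.path (diag X) (diag X) ≫ (ihom Δ[1]).map (fst X X)

/-- The second path of a pair of parallel paths. -/
def freeLoopSnd : HPullback (diag X) (diag X) ⟶ (ihom Δ[1]).obj X :=
  HPullback.path (diag X) (diag X) ≫ (ihom Δ[1]).map (snd X X)

lemma freeLoopFst_zero : freeLoopFst X ≫ endpoint X 0 = HPullback.fst (diag X) (diag X) := by
  rw [freeLoopFst, Category.assoc, endpoint_naturality, ← Category.assoc, HPullback.path_zero]
  rfl

lemma freeLoopSnd_zero : freeLoopSnd X ≫ endpoint X 0 = HPullback.fst (diag X) (diag X) := by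
  rw [freeLoopSnd, Category.assoc, endpoint_naturality, ← Category.assoc, HPullback.path_zero]
  rfl

lemma freeLoopFst_one : freeLoopFst X ≫ endpoint X 1 = HPullback.snd (diag X) (diag X) := by
  rw [freeLoopFst, Category.assoc, endpoint_naturality, ← Category.assoc, HPullback.path_one]
  rfl

lemma freeLoopSnd_one : freeLoopSnd X ≫ endpoint X 1 = HPullback.snd (diag X) (diag X) := by
  rw [freeLoopSnd, Category.assoc, endpoint_naturality, ← Category.assoc, HPullback.path_one]
  rfl

/-- Paths in a product are pairs of paths, so a free loop amounts to two parallel paths; this allows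
each of them to be moved separately. -/
lemma freeLoop_path_eq : HPullback.path (diag X) (diag X) =
    CartesianMonoidalCategory.lift (freeLoopFst X) (freeLoopSnd X) ≫ pairPath X X := by
  rw [freeLoopFst, freeLoopSnd, ← CartesianMonoidalCategory.comp_lift, Category.assoc,
    lift_map_pairPath, Category.comp_id]

variable {X}

lemma freeLoop_hom_ext {Z : SSet.{u}} {a b : Z ⟶ HPullback (diag X) (diag X)}
    (h₁ : a ≫ HPullback.fst (diag X) (diag X) = b ≫ HPullback.fst (diag X) (diag X))
    (h₂ : a ≫ freeLoopFst X = b ≫ freeLoopFst X)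
    (h₃ : a ≫ freeLoopSnd X = b ≫ freeLoopSnd X)
    (h₄ : a ≫ HPullback.snd (diag X) (diag X) = b ≫ HPullback.snd (diag X) (diag X)) :
    a = b := by
  refine HPullback.hom_ext h₁ ?_ h₄
  rw [freeLoop_path_eq, CartesianMonoidalCategory.comp_lift_assoc, h₂, h₃,
    CartesianMonoidalCategory.comp_lift_assoc]

/-- The map to the free loop space given by two parallel paths. -/
def freeLoopLift {Z : SSet.{u}} (a : Z ⟶ X) (p q : Z ⟶ (ihom Δ[1]).obj X) (b : Z ⟶ X)
    (hp₀ : p ≫ endpoint X 0 = a) (hq₀ : q ≫ endpoint X 0 = a) (hp₁ : p ≫ endpoint X 1 = b)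
    (hq₁ : q ≫ endpoint X 1 = b) : Z ⟶ HPullback (diag X) (diag X) :=
  HPullback.lift a (CartesianMonoidalCategory.lift p q ≫ pairPath X X) b
    (by
      rw [Category.assoc, pairPath_endpoint]
      apply CartesianMonoidalCategory.hom_ext <;> simp [diag, hp₀, hq₀])
    (by
      rw [Category.assoc, pairPath_endpoint]
      apply CartesianMonoidalCategory.hom_ext <;> simp [diag, hp₁, hq₁])

lemma pairPath_map_fst (X Y : SSet.{u}) :
    pairPath X Y ≫ (ihom Δ[1]).map (fst X Y) = fst _ _ := by
  apply MonoidalClosed.uncurry_injective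
  rw [MonoidalClosed.uncurry_natural_right, pairPath, MonoidalClosed.uncurry_curry,
    CartesianMonoidalCategory.lift_fst, MonoidalClosed.uncurry_eq]

lemma pairPath_map_snd (X Y : SSet.{u}) :
    pairPath X Y ≫ (ihom Δ[1]).map (snd X Y) = snd _ _ := by
  apply MonoidalClosed.uncurry_injective
  rw [MonoidalClosed.uncurry_natural_right, pairPath, MonoidalClosed.uncurry_curry,
    CartesianMonoidalCategory.lift_snd, MonoidalClosed.uncurry_eq]

section

variable {Z : SSet.{u}} (a : Z ⟶ X) (p q : Z ⟶ (ihom Δ[1]).obj X) (b : Z ⟶ X)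
    (hp₀ : p ≫ endpoint X 0 = a) (hq₀ : q ≫ endpoint X 0 = a) (hp₁ : p ≫ endpoint X 1 = b)
    (hq₁ : q ≫ endpoint X 1 = b)

@[simp]
lemma freeLoopLift_fst : freeLoopLift a p q b hp₀ hq₀ hp₁ hq₁ ≫ freeLoopFst X = p := by
  rw [freeLoopLift, freeLoopFst, HPullback.lift_path_assoc, Category.assoc, pairPath_map_fst,
    CartesianMonoidalCategory.lift_fst]

@[simp]
lemma freeLoopLift_snd : freeLoopLift a p q b hp₀ hq₀ hp₁ hq₁ ≫ freeLoopSnd X = q := by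
  rw [freeLoopLift, freeLoopSnd, HPullback.lift_path_assoc, Category.assoc, pairPath_map_snd,
    CartesianMonoidalCategory.lift_snd]

@[simp]
lemma freeLoopLift_start :
    freeLoopLift a p q b hp₀ hq₀ hp₁ hq₁ ≫ HPullback.fst (diag X) (diag X) = a := rfl

@[simp]
lemma freeLoopLift_end :
    freeLoopLift a p q b hp₀ hq₀ hp₁ hq₁ ≫ HPullback.snd (diag X) (diag X) = b := rfl

end

end

namespace StrictLoop

section

variable (X : SSet.{u})

/-- The inclusion of the strict loops in the free loop space. -/
def toFreeLoop : StrictLoop X ⟶ HPullback (diag X) (diag X) :=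
  freeLoopLift (proj X) (path X) (proj X ≫ constPath X) (proj X)
    (path_endpoint _ _) (by simp [constPath_endpoint]) (path_endpoint _ _)
    (by simp [constPath_endpoint])

@[simp]
lemma toFreeLoop_fst : toFreeLoop X ≫ freeLoopFst X = path X := by simp [toFreeLoop]

@[simp]
lemma toFreeLoop_snd : toFreeLoop X ≫ freeLoopSnd X = proj X ≫ constPath X := by simp [toFreeLoop]

@[simp]
lemma toFreeLoop_start : toFreeLoop X ≫ HPullback.fst (diag X) (diag X) = proj X := rfl

@[simp]
lemma toFreeLoop_end : toFreeLoop X ≫ HPullback.snd (diag X) (diag X) = proj X := rfl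

instance : Mono (toFreeLoop X) := by
  refine ⟨fun a b h ↦ ?_⟩
  rw [← cancel_mono (path X), ← toFreeLoop_fst, reassoc_of% h]

/-- The free loop space of a Kan complex deforms to the space of strict loops. -/
lemma nonempty_deformationRetract_toFreeLoop [SSet.KanComplex X] :
    Nonempty (DeformationRetract (toFreeLoop X)) := by
  -- Given parallel paths `p`, `q` from `a`, the path `q` shrinks to its start and the common end
  -- moves to `q s`, dragging `p` along as `L`. At time `0` the second path is constant and `L` is a
  -- loop at `a`.
  obtain ⟨L, hL, hL'⟩ := exists_path_lift (anodyneExtensions_ι₁ (HPullback (diag X) (diag X)))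
    (freeLoopFst X)
    ![fst _ _ ≫ HPullback.fst (diag X) (diag X), freeLoopSnd X ▷ Δ[1] ≫ evalPath X] (by
      rw [Fin.forall_fin_two]
      constructor
      · simp [freeLoopFst_zero]
      · simp [freeLoopFst_one, freeLoopSnd_one, ι₁_evalPath])
  have hL₀ : L ≫ endpoint X 0 = fst _ _ ≫ HPullback.fst (diag X) (diag X) := hL' 0
  have hL₁ : L ≫ endpoint X 1 = freeLoopSnd X ▷ Δ[1] ≫ evalPath X := hL' 1
  have e : toFreeLoop X ▷ Δ[1] ≫ freeLoopSnd X ▷ Δ[1] = proj X ▷ Δ[1] ≫ constPath X ▷ Δ[1] := by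
    rw [← comp_whiskerRight, toFreeLoop_snd, comp_whiskerRight]
  refine ⟨{
    mono := inferInstance
    h := freeLoopLift (fst _ _ ≫ HPullback.fst (diag X) (diag X)) L
      (freeLoopSnd X ▷ Δ[1] ≫ initialPath X) (freeLoopSnd X ▷ Δ[1] ≫ evalPath X) hL₀
      (by simp [initialPath_endpoint_zero, freeLoopSnd_zero]) hL₁
      (by simp [initialPath_endpoint_one])
    r := lift (SSet.ι₀ ≫ L) (by simp [hL₀, hL₁, ι₀_evalPath, freeLoopSnd_zero])
    h' := lift (toFreeLoop X ▷ Δ[1] ≫ L)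
      (by simp [hL₀, hL₁, reassoc_of% e, constPath_evalPath])
    ι₁_h := ?_
    ι₀_h := ?_
    comm := ?_ }⟩
  · apply freeLoop_hom_ext
    · simp
    · simp [hL]
    · simp [ι₁_initialPath]
    · simp [ι₁_evalPath, freeLoopSnd_one]
  · apply freeLoop_hom_ext
    · simp [proj, reassoc_of% lift_path, hL₀]
    · simp
    · simp [proj, reassoc_of% lift_path, ι₀_initialPath, reassoc_of% freeLoopSnd_zero,
        reassoc_of% hL₀]
    · simp [proj, reassoc_of% lift_path, hL₀, ι₀_evalPath, freeLoopSnd_zero]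
  · apply freeLoop_hom_ext
    · simp [proj, reassoc_of% lift_path, hL₀]
    · simp
    · simp [proj, reassoc_of% lift_path, initialPath, reassoc_of% e, constPath_reparam,
        reassoc_of% hL₀, reassoc_of% toFreeLoop_start]
    · simp [proj, reassoc_of% lift_path, hL₀, reassoc_of% e, constPath_evalPath]

end

end StrictLoop

/-! ### Spaces of partial sections -/

/-- The map `(a, b) ↦ c`, where `c i` is `a i` if `θ (a i) = 0` and `max (a i) (b i)` otherwise. -/
def selMap {n : SimplexCategoryᵒᵖ} (θ : Δ[1].obj n) :
    SSet.stdSimplex.{u}.obj n.unop ⊗ SSet.stdSimplex.obj n.unop ⟶ SSet.stdSimplex.obj n.unop where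
  app _ := ↾fun x ↦ SSet.stdSimplex.objEquiv.symm (SimplexCategory.Hom.mk
    { toFun i :=
        if (SSet.stdSimplex.objEquiv θ).toOrderHom ((SSet.stdSimplex.objEquiv x.1).toOrderHom i) = 0
        then (SSet.stdSimplex.objEquiv x.1).toOrderHom i
        else (SSet.stdSimplex.objEquiv x.1).toOrderHom i ⊔
          (SSet.stdSimplex.objEquiv x.2).toOrderHom i
      monotone' i j h := by
        have h₁ := (SSet.stdSimplex.objEquiv x.1).toOrderHom.monotone h
        have h₂ := (SSet.stdSimplex.objEquiv x.2).toOrderHom.monotone h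
        have h₃ := (SSet.stdSimplex.objEquiv θ).toOrderHom.monotone h₁
        dsimp only
        split_ifs with hi hj hj
        · exact h₁
        · exact h₁.trans le_sup_left
        -- This case does not occur: `θ ∘ a` is monotone and cannot return to `0`.
        · rw [hj] at h₃
          exact absurd (Fin.le_zero_iff.1 h₃) hi
        · exact sup_le_sup h₁ h₂ })
  naturality _ _ _ := rfl

lemma selMap_zero (n : SimplexCategoryᵒᵖ) :
    selMap.{u} (SSet.stdSimplex.const 1 0 n) = fst _ _ := by
  ext d ⟨a, b⟩
  refine stdSimplex_ext fun i ↦ ?_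
  exact if_pos (e := (SSet.stdSimplex.objEquiv a).toOrderHom i ⊔
    (SSet.stdSimplex.objEquiv b).toOrderHom i) (show (0 : Fin 2) = 0 from rfl)

lemma selMap_one (n : SimplexCategoryᵒᵖ) :
    selMap.{u} (SSet.stdSimplex.const 1 1 n) = supMap n.unop := by
  ext d ⟨a, b⟩
  refine stdSimplex_ext fun i ↦ ?_
  exact if_neg (t := (SSet.stdSimplex.objEquiv a).toOrderHom i) (show ¬ (1 : Fin 2) = 0 by decide)

/-- Monotone maps of linear orders preserve maxima, and testing `θ` at the vertex `a i`, rather than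
at `i`, makes the test invariant under reindexing by `γ`. -/
lemma selMap_naturality {n m : SimplexCategoryᵒᵖ} (γ : n ⟶ m) (θ : Δ[1].obj n) :
    selMap.{u} (Δ[1].map γ θ) ≫ SSet.stdSimplex.map γ.unop =
      (SSet.stdSimplex.map γ.unop ⊗ₘ SSet.stdSimplex.map γ.unop) ≫ selMap θ := by
  ext d ⟨a, b⟩
  refine stdSimplex_ext fun i ↦ ?_
  have := γ.unop.toOrderHom.monotone.map_sup
    ((SSet.stdSimplex.objEquiv a).toOrderHom i) ((SSet.stdSimplex.objEquiv b).toOrderHom i)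
  refine Eq.trans (apply_ite _ _ _ _) ?_
  refine if_congr Iff.rfl rfl this

/-- The symmetry of the maximum makes the homotopies starting at `b` and at `a` end at the same
substitution. -/
lemma braiding_supMap (n : SimplexCategory) : (β_ _ _).hom ≫ supMap.{u} n = supMap n := by
  ext d ⟨a, b⟩
  exact stdSimplex_ext fun i ↦ sup_comm _ _

/-- For a map `π : T ⟶ X`, the simplicial set whose `n`-simplices are the maps `Δ[n] × Δ[n] ⟶ T`
which lie over an `n`-simplex of `X`. -/
def PartialSection {T X : SSet.{u}} (π : T ⟶ X) : SSet.{u} where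
  obj n := { y : SSet.stdSimplex.obj n.unop ⊗ SSet.stdSimplex.obj n.unop ⟶ T //
    ∃ σ, y ≫ π = fst _ _ ≫ σ }
  map {n m} γ := ↾fun y ↦ ⟨(SSet.stdSimplex.map γ.unop ⊗ₘ SSet.stdSimplex.map γ.unop) ≫ y.1, by
    obtain ⟨y, σ, h⟩ := y
    exact ⟨SSet.stdSimplex.map γ.unop ≫ σ, by simp [h]⟩⟩
  map_id n := by
    apply ConcreteCategory.hom_ext
    intro y
    apply Subtype.ext
    have h : SSet.stdSimplex.{u}.map (𝟙 n.unop) = 𝟙 _ := CategoryTheory.Functor.map_id _ _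
    exact congrArg (fun k ↦ (k ⊗ₘ k) ≫ y.1) h
  map_comp {n m k} γ δ := by
    apply ConcreteCategory.hom_ext
    intro y
    apply Subtype.ext
    have h : SSet.stdSimplex.{u}.map (δ.unop ≫ γ.unop) = SSet.stdSimplex.map δ.unop ≫
      SSet.stdSimplex.map γ.unop := CategoryTheory.Functor.map_comp _ _ _
    exact congrArg (fun k ↦ (k ⊗ₘ k) ≫ y.1) h

namespace PartialSection

section

variable {T X : SSet.{u}} (π : T ⟶ X)

/-- The restriction to the diagonal. -/
def toTotal : PartialSection π ⟶ T where
  app n := ↾fun y ↦ SSet.yonedaEquiv (CartesianMonoidalCategory.lift (𝟙 _) (𝟙 _) ≫ y.1)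
  naturality n m γ := by
    ext y
    change SSet.yonedaEquiv (CartesianMonoidalCategory.lift (𝟙 _) (𝟙 _) ≫
      (SSet.stdSimplex.map γ.unop ⊗ₘ SSet.stdSimplex.map γ.unop) ≫ y.1) = T.map γ _
    exact (SSet.yonedaEquiv_naturality γ.unop
      (CartesianMonoidalCategory.lift (𝟙 _) (𝟙 _) ≫ y.1)).symm

/-- A simplex gives a family which is constant in the second variable. -/
def ofTotal : T ⟶ PartialSection π where
  app n := ↾fun t ↦ ⟨fst _ _ ≫ SSet.yonedaEquiv.symm t, _, Category.assoc _ _ _⟩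
  naturality n m γ := by
    ext t
    apply Subtype.ext
    change fst _ _ ≫ SSet.yonedaEquiv.symm (T.map γ t) =
      (SSet.stdSimplex.map γ.unop ⊗ₘ SSet.stdSimplex.map γ.unop) ≫ fst _ _ ≫ SSet.yonedaEquiv.symm t
    rw [tensorHom_fst_assoc, SSet.yonedaEquiv_symm_naturality_left]
    rfl

lemma ofTotal_toTotal : ofTotal π ≫ toTotal π = 𝟙 T := by
  ext n t
  exact SSet.yonedaEquiv.apply_symm_apply t

/-- Substitution in the second variable. -/
def substitution (k : ∀ {n : SimplexCategoryᵒᵖ} (_ : Δ[1].obj n),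
      SSet.stdSimplex.{u}.obj n.unop ⊗ SSet.stdSimplex.obj n.unop ⟶ SSet.stdSimplex.obj n.unop)
    (hk : ∀ {n m : SimplexCategoryᵒᵖ} (γ : n ⟶ m) (θ : Δ[1].obj n),
      k (Δ[1].map γ θ) ≫ SSet.stdSimplex.map γ.unop =
      (SSet.stdSimplex.map γ.unop ⊗ₘ SSet.stdSimplex.map γ.unop) ≫ k θ) :
    PartialSection π ⊗ Δ[1] ⟶ PartialSection π where
  app n := ↾fun x ↦ ⟨CartesianMonoidalCategory.lift (fst _ _) (k x.2) ≫ x.1.1, by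
    obtain ⟨⟨y, σ, h⟩, θ⟩ := x
    exact ⟨σ, by simp [h]⟩⟩
  naturality n m γ := by
    ext ⟨y, θ⟩
    apply Subtype.ext
    change CartesianMonoidalCategory.lift (fst _ _) (k (Δ[1].map γ θ)) ≫
      (SSet.stdSimplex.map γ.unop ⊗ₘ SSet.stdSimplex.map γ.unop) ≫ y.1 =
      (SSet.stdSimplex.map γ.unop ⊗ₘ SSet.stdSimplex.map γ.unop) ≫
        CartesianMonoidalCategory.lift (fst _ _) (k θ) ≫ y.1
    rw [← Category.assoc, ← Category.assoc]
    congr 1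
    apply CartesianMonoidalCategory.hom_ext
    · simp
    · simp [hk]

/-- The homotopy from the identity to the substitution of the maximum. -/
def homotopySup : PartialSection π ⊗ Δ[1] ⟶ PartialSection π :=
  substitution π (fun θ ↦ (β_ _ _).hom ≫ selMap θ) fun γ θ ↦ by
    rw [Category.assoc, selMap_naturality]
    rfl

/-- The homotopy from the restriction to the diagonal to the substitution of the maximum. -/
def homotopySup' : PartialSection π ⊗ Δ[1] ⟶ PartialSection π :=
  substitution π selMap selMap_naturality

lemma ι₀_homotopySup : SSet.ι₀ ≫ homotopySup π = 𝟙 _ := by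
  ext n y
  apply Subtype.ext
  change CartesianMonoidalCategory.lift (fst _ _) ((β_ _ _).hom ≫
    selMap (SSet.stdSimplex.const 1 0 n)) ≫ y.1 = y.1
  rw [selMap_zero]
  exact Category.id_comp y.1

lemma ι₁_homotopySup : SSet.ι₁ ≫ homotopySup π = SSet.ι₁ ≫ homotopySup' π := by
  ext n y
  apply Subtype.ext
  change CartesianMonoidalCategory.lift (fst _ _) ((β_ _ _).hom ≫
    selMap (SSet.stdSimplex.const 1 1 n)) ≫ y.1 = CartesianMonoidalCategory.lift (fst _ _)
    (selMap (SSet.stdSimplex.const 1 1 n)) ≫ y.1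
  rw [selMap_one, braiding_supMap]

lemma ι₀_homotopySup' : SSet.ι₀ ≫ homotopySup' π = toTotal π ≫ ofTotal π := by
  ext n y
  apply Subtype.ext
  change CartesianMonoidalCategory.lift (fst _ _) (selMap (SSet.stdSimplex.const 1 0 n)) ≫ y.1 =
    fst _ _ ≫ SSet.yonedaEquiv.symm (SSet.yonedaEquiv _)
  rw [selMap_zero, Equiv.symm_apply_apply]
  rfl

/-- Both `y (a, b)` and `y (a, a)` deform to `y (a, max a b)`, which gives a zigzag of two
homotopies. The first argument, which alone determines the simplex of `X`, never changes, so nothing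
is required of `π`. -/
lemma isWeakEquiv_toTotal : IsWeakEquiv (toTotal π) := by
  refine isWeakEquiv_of_weakHomotopic _ (ofTotal π) ?_ ?_
  · exact (WeakHomotopic.of_homotopy (homotopySup' π) (ι₀_homotopySup' π)
      (ι₁_homotopySup π).symm).trans
        (WeakHomotopic.of_homotopy (homotopySup π) (ι₀_homotopySup π) rfl).symm
  · rw [ofTotal_toTotal]
    exact WeakHomotopic.refl _

end

section

variable {T T' X X' : SSet.{u}} {π : T ⟶ X} {π' : T' ⟶ X'} (τ : T ⟶ T') (χ : X ⟶ X')
  (h : τ ≫ π' = π ≫ χ)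

/-- Functoriality of the spaces of partial sections. -/
def map : PartialSection π ⟶ PartialSection π' where
  app n := ↾fun y ↦ ⟨y.1 ≫ τ, by
    obtain ⟨y, σ, h'⟩ := y
    exact ⟨σ ≫ χ, by rw [Category.assoc, h, reassoc_of% h']⟩⟩
  naturality n m γ := rfl

lemma map_toTotal : map τ χ h ≫ toTotal π' = toTotal π ≫ τ := rfl

lemma ofTotal_map : ofTotal π ≫ map τ χ h = τ ≫ ofTotal π' := by
  ext n t
  apply Subtype.ext
  change (fst _ _ ≫ SSet.yonedaEquiv.symm t) ≫ τ = fst _ _ ≫ SSet.yonedaEquiv.symm (τ.app n t)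
  rw [Category.assoc, SSet.yonedaEquiv_symm_comp]

end

end PartialSection

/-! ### Evaluations -/

/-- A map `K × S ⟶ T` which exhibits `S` as the mapping space from `K` to `T`. -/
def IsEvaluation {K S T : SSet.{u}} (ε : K ⊗ S ⟶ T) : Prop :=
  ∀ Z : SSet.{u}, Function.Bijective (fun z : Z ⟶ S ↦ K ◁ z ≫ ε)

/-- The evaluation of maps `K ⟶ X`. -/
abbrev evaluation (K X : SSet.{u}) : K ⊗ (ihom K).obj X ⟶ X := (ihom.ev K).app X

lemma isEvaluation_evaluation (K X : SSet.{u}) : IsEvaluation (evaluation K X) := by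
  intro Z
  have h : (fun z : Z ⟶ (ihom K).obj X ↦ K ◁ z ≫ evaluation K X) = MonoidalClosed.uncurry := by
    funext z
    rw [MonoidalClosed.uncurry_eq]
  rw [h]
  exact ((ihom.adjunction K).homEquiv Z X).symm.bijective

lemma whiskerLeft_curry'_evaluation {K X : SSet.{u}} (σ : K ⟶ X) :
    K ◁ MonoidalClosed.curry' σ ≫ evaluation K X = fst _ _ ≫ σ := by
  rw [MonoidalClosed.curry', MonoidalClosed.whiskerLeft_curry_ihom_ev_app]
  rfl

/-- The evaluation of pairs. -/
def pairEv {K S T : SSet.{u}} (ε : K ⊗ S ⟶ T) : K ⊗ (S ⊗ S) ⟶ T ⊗ T :=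
  CartesianMonoidalCategory.lift (K ◁ fst _ _ ≫ ε) (K ◁ snd _ _ ≫ ε)

lemma IsEvaluation.pairEv {K S T : SSet.{u}} {ε : K ⊗ S ⟶ T} (h : IsEvaluation ε) :
    IsEvaluation (pairEv ε) := by
  refine fun Z ↦ ⟨fun z z' hz ↦ ?_, fun y ↦ ?_⟩
  · apply CartesianMonoidalCategory.hom_ext
    · exact (h Z).1 (congrArg (· ≫ fst _ _) hz)
    · exact (h Z).1 (congrArg (· ≫ snd _ _) hz)
  · obtain ⟨a, ha⟩ := (h Z).2 (y ≫ fst _ _)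
    obtain ⟨b, hb⟩ := (h Z).2 (y ≫ snd _ _)
    exact ⟨CartesianMonoidalCategory.lift a b, CartesianMonoidalCategory.hom_ext _ _ ha hb⟩

lemma pairEv_square {K S T K' S' T' : SSet.{u}} {ε : K ⊗ S ⟶ T} {ε' : K' ⊗ S' ⟶ T'} {κ : K' ⟶ K}
    {ρ : S ⟶ S'} {τ : T ⟶ T'} (h : K' ◁ ρ ≫ ε' = κ ▷ S ≫ ε ≫ τ) :
    K' ◁ (ρ ⊗ₘ ρ) ≫ pairEv ε' = κ ▷ (S ⊗ S) ≫ pairEv ε ≫ (τ ⊗ₘ τ) := by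
  apply CartesianMonoidalCategory.hom_ext
  · exact congrArg (K' ◁ fst _ _ ≫ ·) h
  · exact congrArg (K' ◁ snd _ _ ≫ ·) h

/-- The symmetry of the first two factors. -/
def swapFactors (A B C : SSet.{u}) : A ⊗ (B ⊗ C) ⟶ B ⊗ (A ⊗ C) :=
  CartesianMonoidalCategory.lift (snd _ _ ≫ fst _ _)
    (CartesianMonoidalCategory.lift (fst _ _) (snd _ _ ≫ snd _ _))

/-- The evaluation of paths. -/
def pathEv {K S T : SSet.{u}} (ε : K ⊗ S ⟶ T) : K ⊗ (ihom Δ[1]).obj S ⟶ (ihom Δ[1]).obj T :=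
  MonoidalClosed.curry (swapFactors _ _ _ ≫ K ◁ (ihom.ev Δ[1]).app S ≫ ε)

lemma pathEv_endpoint {K S T : SSet.{u}} (ε : K ⊗ S ⟶ T) (i : Fin 2) :
    pathEv ε ≫ endpoint T i = K ◁ endpoint S i ≫ ε := by
  rw [pathEv, curry_endpoint]
  rfl

lemma uncurry_pathEv {K S T Z : SSet.{u}} (ε : K ⊗ S ⟶ T) (z : Z ⟶ (ihom Δ[1]).obj S) :
    MonoidalClosed.uncurry (K ◁ z ≫ pathEv ε) =
      swapFactors _ _ _ ≫ K ◁ MonoidalClosed.uncurry z ≫ ε := by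
  rw [pathEv, ← MonoidalClosed.curry_natural_left, MonoidalClosed.uncurry_curry,
    MonoidalClosed.uncurry_eq]
  rfl

/-- Exchanging `K` and `Δ[1]` turns a map from `K ⊗ Z` to paths in `T` into a map `K ⊗ (Δ[1] ⊗ Z) ⟶
T`, to which the hypothesis on `ε` applies. -/
lemma IsEvaluation.pathEv {K S T : SSet.{u}} {ε : K ⊗ S ⟶ T} (h : IsEvaluation ε) :
    IsEvaluation (pathEv ε) := by
  refine fun Z ↦ ⟨fun z z' hz ↦ ?_, fun y ↦ ?_⟩
  · apply MonoidalClosed.uncurry_injective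
    apply (h _).1
    have e := congrArg (fun k ↦ swapFactors _ _ _ ≫ MonoidalClosed.uncurry k) hz
    dsimp only at e
    rw [uncurry_pathEv, uncurry_pathEv] at e
    exact e
  · obtain ⟨a, ha⟩ := (h _).2 (swapFactors _ _ _ ≫ MonoidalClosed.uncurry y)
    refine ⟨MonoidalClosed.curry a, ?_⟩
    apply MonoidalClosed.uncurry_injective
    dsimp only at ha ⊢
    rw [uncurry_pathEv, MonoidalClosed.uncurry_curry, ha]
    rfl

lemma pathEv_square {K S T K' S' T' : SSet.{u}} {ε : K ⊗ S ⟶ T} {ε' : K' ⊗ S' ⟶ T'} {κ : K' ⟶ K}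
    {ρ : S ⟶ S'} {τ : T ⟶ T'} (h : K' ◁ ρ ≫ ε' = κ ▷ S ≫ ε ≫ τ) :
    K' ◁ (ihom Δ[1]).map ρ ≫ pathEv ε' =
      κ ▷ (ihom Δ[1]).obj S ≫ pathEv ε ≫ (ihom Δ[1]).map τ := by
  rw [pathEv, pathEv, ← MonoidalClosed.curry_natural_left, ← MonoidalClosed.curry_natural_right,
    ← MonoidalClosed.curry_natural_left]
  congr 1
  exact congrArg (swapFactors _ _ _ ≫ K' ◁ (ihom.ev Δ[1]).app S ≫ ·) h

section

variable {K A B C A' B' C' : SSet.{u}} {f : A ⟶ C} {g : B ⟶ C} {f' : A' ⟶ C'} {g' : B' ⟶ C'}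

/-- The evaluation of points of homotopy pullbacks. -/
def hPullbackEv (α : K ⊗ A ⟶ A') (β : K ⊗ B ⟶ B') (γ : K ⊗ C ⟶ C') (hf : K ◁ f ≫ γ = α ≫ f')
    (hg : K ◁ g ≫ γ = β ≫ g') : K ⊗ HPullback f g ⟶ HPullback f' g' :=
  HPullback.lift (K ◁ HPullback.fst f g ≫ α) (K ◁ HPullback.path f g ≫ pathEv γ)
    (K ◁ HPullback.snd f g ≫ β)
    (by rw [Category.assoc, pathEv_endpoint, ← MonoidalCategory.whiskerLeft_comp_assoc,
      HPullback.path_zero, MonoidalCategory.whiskerLeft_comp_assoc, hf, Category.assoc])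
    (by rw [Category.assoc, pathEv_endpoint, ← MonoidalCategory.whiskerLeft_comp_assoc,
      HPullback.path_one, MonoidalCategory.whiskerLeft_comp_assoc, hg, Category.assoc])

variable {α : K ⊗ A ⟶ A'} {β : K ⊗ B ⟶ B'} {γ : K ⊗ C ⟶ C'} {hf : K ◁ f ≫ γ = α ≫ f'}
    {hg : K ◁ g ≫ γ = β ≫ g'}

@[simp]
lemma hPullbackEv_fst : hPullbackEv α β γ hf hg ≫ HPullback.fst f' g' =
    K ◁ HPullback.fst f g ≫ α := by simp [hPullbackEv]

@[simp]
lemma hPullbackEv_path : hPullbackEv α β γ hf hg ≫ HPullback.path f' g' =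
    K ◁ HPullback.path f g ≫ pathEv γ := by simp [hPullbackEv]

@[simp]
lemma hPullbackEv_snd : hPullbackEv α β γ hf hg ≫ HPullback.snd f' g' =
    K ◁ HPullback.snd f g ≫ β := by simp [hPullbackEv]

/-- The conditions on `α` and `β` concern only the given pair because `α` is not always an
evaluation: for a fibre it is the constant family `fst _ _ ≫ σ` on a point, and for an incidence
correspondence it is `loopEv σ`, which parametrizes only maps over `σ`. For the same reason
`exists_hPullbackEv_lift` takes the lifts to `A` and `B` as data. -/
lemma hPullbackEv_injective (hγ : IsEvaluation γ) {Z : SSet.{u}} {z z' : Z ⟶ HPullback f g}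
    (h : K ◁ z ≫ hPullbackEv α β γ hf hg = K ◁ z' ≫ hPullbackEv α β γ hf hg)
    (hα : K ◁ (z ≫ HPullback.fst f g) ≫ α = K ◁ (z' ≫ HPullback.fst f g) ≫ α →
      z ≫ HPullback.fst f g = z' ≫ HPullback.fst f g)
    (hβ : K ◁ (z ≫ HPullback.snd f g) ≫ β = K ◁ (z' ≫ HPullback.snd f g) ≫ β →
      z ≫ HPullback.snd f g = z' ≫ HPullback.snd f g) : z = z' := by
  apply HPullback.hom_ext
  · apply hα
    simpa using congrArg (· ≫ HPullback.fst f' g') h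
  · apply (hγ.pathEv Z).1
    simpa using congrArg (· ≫ HPullback.path f' g') h
  · apply hβ
    simpa using congrArg (· ≫ HPullback.snd f' g') h

lemma exists_hPullbackEv_lift (hγ : IsEvaluation γ) {Z : SSet.{u}} (y : K ⊗ Z ⟶ HPullback f' g')
    (a : Z ⟶ A) (ha : K ◁ a ≫ α = y ≫ HPullback.fst f' g')
    (b : Z ⟶ B) (hb : K ◁ b ≫ β = y ≫ HPullback.snd f' g') :
    ∃ z : Z ⟶ HPullback f g, K ◁ z ≫ hPullbackEv α β γ hf hg = y := by
  obtain ⟨h, hh⟩ := (hγ.pathEv Z).2 (y ≫ HPullback.path f' g')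
  dsimp only at hh
  refine ⟨HPullback.lift a h b ?_ ?_, ?_⟩
  · apply (hγ Z).1
    dsimp only
    rw [MonoidalCategory.whiskerLeft_comp_assoc, ← pathEv_endpoint, reassoc_of% hh,
      HPullback.path_zero, MonoidalCategory.whiskerLeft_comp_assoc, hf, reassoc_of% ha]
  · apply (hγ Z).1
    dsimp only
    rw [MonoidalCategory.whiskerLeft_comp_assoc, ← pathEv_endpoint, reassoc_of% hh,
      HPullback.path_one, MonoidalCategory.whiskerLeft_comp_assoc, hg, reassoc_of% hb]
  · apply HPullback.hom_ext
    · rw [Category.assoc, hPullbackEv_fst, ← MonoidalCategory.whiskerLeft_comp_assoc,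
        HPullback.lift_fst, ha]
    · rw [Category.assoc, hPullbackEv_path, ← MonoidalCategory.whiskerLeft_comp_assoc,
        HPullback.lift_path, hh]
    · rw [Category.assoc, hPullbackEv_snd, ← MonoidalCategory.whiskerLeft_comp_assoc,
        HPullback.lift_snd, hb]

lemma isEvaluation_hPullbackEv (hα : IsEvaluation α) (hβ : IsEvaluation β) (hγ : IsEvaluation γ) :
    IsEvaluation (hPullbackEv α β γ hf hg) := by
  refine fun Z ↦ ⟨fun z z' hz ↦ ?_, fun y ↦ ?_⟩
  · exact hPullbackEv_injective hγ hz (fun h ↦ (hα Z).1 h) (fun h ↦ (hβ Z).1 h)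
  · obtain ⟨a, ha⟩ := (hα Z).2 (y ≫ HPullback.fst f' g')
    obtain ⟨b, hb⟩ := (hβ Z).2 (y ≫ HPullback.snd f' g')
    exact exists_hPullbackEv_lift hγ y a ha b hb

/-- The map `κ` accounts for simplicial operators between the `Δ[n]`, the maps `ρᵢ` and `τᵢ` for a
change of cospan. The first gives `ev_map` for the section families, the second the naturality of
`fibreSumIso`. -/
lemma hPullbackEv_square {L P Q R P' Q' R' : SSet.{u}} {k : P ⟶ R} {l : Q ⟶ R} {k' : P' ⟶ R'}
    {l' : Q' ⟶ R'} {α' : L ⊗ P ⟶ P'} {β' : L ⊗ Q ⟶ Q'} {γ' : L ⊗ R ⟶ R'}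
    {hk : L ◁ k ≫ γ' = α' ≫ k'} {hl : L ◁ l ≫ γ' = β' ≫ l'} {κ : L ⟶ K}
    {ρ : HPullback f g ⟶ HPullback k l} {τ : HPullback f' g' ⟶ HPullback k' l'}
    {ρ₁ : A ⟶ P} {ρ₂ : B ⟶ Q} {ρ₃ : C ⟶ R} {τ₁ : A' ⟶ P'} {τ₂ : B' ⟶ Q'} {τ₃ : C' ⟶ R'}
    (h₁ : L ◁ ρ₁ ≫ α' = κ ▷ A ≫ α ≫ τ₁) (h₂ : L ◁ ρ₂ ≫ β' = κ ▷ B ≫ β ≫ τ₂)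
    (h₃ : L ◁ ρ₃ ≫ γ' = κ ▷ C ≫ γ ≫ τ₃)
    (r₁ : ρ ≫ HPullback.fst k l = HPullback.fst f g ≫ ρ₁)
    (r₂ : ρ ≫ HPullback.snd k l = HPullback.snd f g ≫ ρ₂)
    (r₃ : ρ ≫ HPullback.path k l = HPullback.path f g ≫ (ihom Δ[1]).map ρ₃)
    (t₁ : τ ≫ HPullback.fst k' l' = HPullback.fst f' g' ≫ τ₁)
    (t₂ : τ ≫ HPullback.snd k' l' = HPullback.snd f' g' ≫ τ₂)
    (t₃ : τ ≫ HPullback.path k' l' = HPullback.path f' g' ≫ (ihom Δ[1]).map τ₃) :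
    L ◁ ρ ≫ hPullbackEv α' β' γ' hk hl = κ ▷ _ ≫ hPullbackEv α β γ hf hg ≫ τ := by
  apply HPullback.hom_ext
  · simp only [Category.assoc, hPullbackEv_fst, t₁, ← MonoidalCategory.whiskerLeft_comp_assoc, r₁]
    rw [MonoidalCategory.whiskerLeft_comp_assoc, h₁, reassoc_of% hPullbackEv_fst,
      whisker_exchange_assoc]
  · simp only [Category.assoc, hPullbackEv_path, t₃, ← MonoidalCategory.whiskerLeft_comp_assoc, r₃]
    rw [MonoidalCategory.whiskerLeft_comp_assoc, pathEv_square h₃, reassoc_of% hPullbackEv_path,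
      whisker_exchange_assoc]
  · simp only [Category.assoc, hPullbackEv_snd, t₂, ← MonoidalCategory.whiskerLeft_comp_assoc, r₂]
    rw [MonoidalCategory.whiskerLeft_comp_assoc, h₂, reassoc_of% hPullbackEv_snd,
      whisker_exchange_assoc]

end

/-! ### Families of sections -/

/-- A structure on `F` which identifies, for every simplex `σ : Δ[n] ⟶ X`, the simplicial set `F σ`
with that of the maps `Δ[n] ⟶ T` over `σ`. -/
structure SectionFamily {T X : SSet.{u}} (F : X.Elements ⥤ SSet.{u}) (π : T ⟶ X) where
  /-- The evaluation of sections. -/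
  ev (p : X.Elements) : SSet.stdSimplex.obj p.1.unop ⊗ F.obj p ⟶ T
  ev_proj (p : X.Elements) : ev p ≫ π = fst _ _ ≫ SSet.yonedaEquiv.symm p.2
  ev_map {p q : X.Elements} (α : p ⟶ q) : SSet.stdSimplex.obj q.1.unop ◁ F.map α ≫ ev q =
    SSet.stdSimplex.map α.1.unop ▷ F.obj p ≫ ev p
  injective {p : X.Elements} {Z : SSet.{u}} (z z' : Z ⟶ F.obj p)
    (h : SSet.stdSimplex.obj p.1.unop ◁ z ≫ ev p = SSet.stdSimplex.obj p.1.unop ◁ z' ≫ ev p) :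
    z = z'
  exists_lift {p : X.Elements} {Z : SSet.{u}} (y : SSet.stdSimplex.obj p.1.unop ⊗ Z ⟶ T)
    (h : y ≫ π = fst _ _ ≫ SSet.yonedaEquiv.symm p.2) :
    ∃ z, SSet.stdSimplex.obj p.1.unop ◁ z ≫ ev p = y

namespace SectionFamily

variable {T X : SSet.{u}} {F : X.Elements ⥤ SSet.{u}} {π : T ⟶ X} (S : SectionFamily F π)

/-- The comparison of the homotopy sum with the simplicial set of partial sections. -/
def comparison : homotopySum X F ⟶ PartialSection π where
  app n := ↾fun x ↦ ⟨SSet.stdSimplex.obj n.unop ◁ SSet.yonedaEquiv.symm x.2 ≫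
    S.ev (X.elementsMk n x.1), SSet.yonedaEquiv.symm x.1, by
      rw [Category.assoc, S.ev_proj]
      rfl⟩
  naturality n m γ := by
    apply ConcreteCategory.hom_ext
    rintro ⟨σ, a⟩
    apply Subtype.ext
    let α : X.elementsMk n σ ⟶ X.elementsMk m (X.map γ σ) := CategoryOfElements.homMk _ _ γ rfl
    let b : (F.obj (X.elementsMk n σ)).obj n := a
    change SSet.stdSimplex.obj m.unop ◁ SSet.yonedaEquiv.symm
      ((F.map α).app m ((F.obj (X.elementsMk n σ)).map γ b)) ≫ S.ev (X.elementsMk m (X.map γ σ)) =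
      (SSet.stdSimplex.map γ.unop ⊗ₘ SSet.stdSimplex.map γ.unop) ≫
        SSet.stdSimplex.obj n.unop ◁ SSet.yonedaEquiv.symm b ≫ S.ev (X.elementsMk n σ)
    have h₁ : SSet.yonedaEquiv.symm ((F.map α).app m ((F.obj (X.elementsMk n σ)).map γ b)) =
        (SSet.stdSimplex.map γ.unop ≫ SSet.yonedaEquiv.symm b) ≫ F.map α := by
      rw [SSet.yonedaEquiv_symm_naturality_left, SSet.yonedaEquiv_symm_comp]
      rfl
    have h₂ := S.ev_map α
    rw [h₁]
    have h₃ := congrArg (SSet.stdSimplex.obj m.unop ◁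
      (SSet.stdSimplex.map γ.unop ≫ SSet.yonedaEquiv.symm b) ≫ ·) h₂
    exact h₃

/-- After `π`, each side is the first projection followed by the base simplex, and the diagonal of
`Δ[n]` is a section of that projection. -/
lemma eq_of_ev_eq {n : SimplexCategoryᵒᵖ} {σ σ' : X.obj n}
    (z : SSet.stdSimplex.obj n.unop ⟶ F.obj (X.elementsMk n σ))
    (z' : SSet.stdSimplex.obj n.unop ⟶ F.obj (X.elementsMk n σ'))
    (h : SSet.stdSimplex.obj n.unop ◁ z ≫ S.ev (X.elementsMk n σ) =
      SSet.stdSimplex.obj n.unop ◁ z' ≫ S.ev (X.elementsMk n σ')) : σ = σ' := by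
  have h₁ : SSet.stdSimplex.obj n.unop ◁ z ≫ S.ev (X.elementsMk n σ) ≫ π =
      SSet.stdSimplex.obj n.unop ◁ z' ≫ S.ev (X.elementsMk n σ') ≫ π := by
    rw [← Category.assoc, h, Category.assoc]
  rw [S.ev_proj, S.ev_proj] at h₁
  exact SSet.yonedaEquiv.symm.injective
    (congrArg (CartesianMonoidalCategory.lift (𝟙 _) (𝟙 _) ≫ ·) h₁)

lemma comparison_injective (n : SimplexCategoryᵒᵖ) :
    Function.Injective (S.comparison.app n) := by
  rintro ⟨σ, a⟩ ⟨σ', a'⟩ h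
  have h₁ : SSet.stdSimplex.obj n.unop ◁ SSet.yonedaEquiv.symm a ≫ S.ev (X.elementsMk n σ) =
    SSet.stdSimplex.obj n.unop ◁ SSet.yonedaEquiv.symm a' ≫ S.ev (X.elementsMk n σ') :=
    congrArg Subtype.val h
  obtain rfl : σ = σ' := S.eq_of_ev_eq _ _ h₁
  obtain rfl : a = a' := SSet.yonedaEquiv.symm.injective
    (S.injective (p := X.elementsMk n σ) _ _ h₁)
  rfl

lemma comparison_surjective (n : SimplexCategoryᵒᵖ) :
    Function.Surjective (S.comparison.app n) := by
  rintro ⟨y, σ, h⟩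
  obtain ⟨z, hz⟩ := S.exists_lift (p := X.elementsMk n (SSet.yonedaEquiv σ)) y (by
    rw [h]
    congr 1
    exact (SSet.yonedaEquiv.symm_apply_apply σ).symm)
  refine ⟨⟨SSet.yonedaEquiv σ, SSet.yonedaEquiv z⟩, Subtype.ext ?_⟩
  change SSet.stdSimplex.obj n.unop ◁ SSet.yonedaEquiv.symm (SSet.yonedaEquiv z) ≫
    S.ev (X.elementsMk n (SSet.yonedaEquiv σ)) = y
  rw [Equiv.symm_apply_apply]
  exact hz

/-- An `n`-simplex of `F σ` is a map `Δ[n] ⟶ F σ`, which by the universal property of `ev` is a map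
`Δ[n] × Δ[n] ⟶ T` over `σ` in the first variable. -/
instance isIso_comparison : IsIso S.comparison := by
  rw [NatTrans.isIso_iff_isIso_app]
  intro n
  exact (isIso_iff_bijective _).2 ⟨S.comparison_injective n, S.comparison_surjective n⟩

/-- The map from the homotopy sum of a family of sections to the total space. -/
def toTotal : homotopySum X F ⟶ T := S.comparison ≫ PartialSection.toTotal π

lemma isWeakEquiv_toTotal : IsWeakEquiv S.toTotal := by
  refine IsWeakEquiv.comp ?_ (PartialSection.isWeakEquiv_toTotal π)
  refine isWeakEquiv_of_weakHomotopic _ (inv S.comparison) ?_ ?_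
  · rw [IsIso.hom_inv_id]
    exact WeakHomotopic.refl _
  · rw [IsIso.inv_hom_id]
    exact WeakHomotopic.refl _

lemma toTotal_proj : S.toTotal ≫ π = homotopySumProj X F := by
  ext n ⟨σ, a⟩
  let b : (F.obj (X.elementsMk n σ)).obj n := a
  have h : CartesianMonoidalCategory.lift (𝟙 _) (𝟙 _) ≫
      SSet.stdSimplex.obj n.unop ◁ SSet.yonedaEquiv.symm b ≫ S.ev (X.elementsMk n σ) ≫ π =
      SSet.yonedaEquiv.symm σ := by
    rw [S.ev_proj]
    rfl
  have := congrArg SSet.yonedaEquiv h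
  rw [Equiv.apply_symm_apply] at this
  exact this

end SectionFamily

/-! ### The family of fibres as a family of sections -/

lemma evaluation_square_pre {K K' : SSet.{u}} (κ : K' ⟶ K) (X : SSet.{u}) :
    K' ◁ (MonoidalClosed.pre κ).app X ≫ evaluation K' X =
      κ ▷ _ ≫ evaluation K X ≫ 𝟙 X := by
  refine Eq.trans ?_ (congrArg (κ ▷ _ ≫ ·) (Category.comp_id _).symm)
  exact MonoidalClosed.id_tensor_pre_app_comp_ev κ X

lemma evaluation_square_map (K : SSet.{u}) {X Y : SSet.{u}} (f : X ⟶ Y) :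
    K ◁ (ihom K).map f ≫ evaluation K Y = 𝟙 K ▷ _ ≫ evaluation K X ≫ f := by
  rw [id_whiskerRight, Category.id_comp]
  exact (ihom.ev K).naturality f

/-- The evaluation of points of the fibre of `q` over a map `σ : K ⟶ X`. -/
def fibreEv {K Y X : SSet.{u}} (q : Y ⟶ X) (σ : K ⟶ X) :
    K ⊗ HPullback (MonoidalClosed.curry' σ) ((ihom K).map q) ⟶ HPullback (𝟙 X) q :=
  hPullbackEv (fst _ _ ≫ σ) (evaluation K Y) (evaluation K X)
    (by rw [whiskerLeft_curry'_evaluation, Category.comp_id]) ((ihom.ev K).naturality q)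

lemma unit_hom_ext {Z : SSet.{u}} (a b : Z ⟶ 𝟙_ SSet.{u}) : a = b :=
  CartesianMonoidalCategory.toUnit_unique a b

lemma fibreEv_square {K L Y X Y' X' : SSet.{u}} {q : Y ⟶ X} {q' : Y' ⟶ X'} {σ : K ⟶ X}
    {σ' : L ⟶ X'} {κ : L ⟶ K} {l : Y ⟶ Y'} {r : X ⟶ X'} (hσ : κ ≫ σ ≫ r = σ')
    {ρ₂ : (ihom K).obj Y ⟶ (ihom L).obj Y'} {ρ₃ : (ihom K).obj X ⟶ (ihom L).obj X'}
    {ρ : HPullback (MonoidalClosed.curry' σ) ((ihom K).map q) ⟶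
      HPullback (MonoidalClosed.curry' σ') ((ihom L).map q')}
    {τ : HPullback (𝟙 X) q ⟶ HPullback (𝟙 X') q'}
    (h₂ : L ◁ ρ₂ ≫ evaluation L Y' = κ ▷ _ ≫ evaluation K Y ≫ l)
    (h₃ : L ◁ ρ₃ ≫ evaluation L X' = κ ▷ _ ≫ evaluation K X ≫ r)
    (r₂ : ρ ≫ HPullback.snd _ _ = HPullback.snd _ _ ≫ ρ₂)
    (r₃ : ρ ≫ HPullback.path _ _ = HPullback.path _ _ ≫ (ihom Δ[1]).map ρ₃)
    (t₁ : τ ≫ HPullback.fst (𝟙 X') q' = HPullback.fst (𝟙 X) q ≫ r)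
    (t₂ : τ ≫ HPullback.snd (𝟙 X') q' = HPullback.snd (𝟙 X) q ≫ l)
    (t₃ : τ ≫ HPullback.path (𝟙 X') q' = HPullback.path (𝟙 X) q ≫ (ihom Δ[1]).map r) :
    L ◁ ρ ≫ fibreEv q' σ' = κ ▷ _ ≫ fibreEv q σ ≫ τ := by
  refine hPullbackEv_square (ρ₁ := 𝟙 _) ?_ h₂ h₃ (unit_hom_ext _ _) r₂ r₃ t₁ t₂ t₃
  rw [← hσ]
  rfl

lemma stdSimplex_map_yonedaEquiv {X : SSet.{u}} {p p' : X.Elements} (α : p ⟶ p') :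
    SSet.stdSimplex.map α.1.unop ≫ SSet.yonedaEquiv.symm p.2 = SSet.yonedaEquiv.symm p'.2 := by
  rw [SSet.yonedaEquiv_symm_naturality_left]
  exact congrArg SSet.yonedaEquiv.symm α.2

/-- The fibres of `q` are the sections of a fibration equivalent to `q`. -/
def fibreSectionFamily {Y X : SSet.{u}} (q : Y ⟶ X) :
    SectionFamily (fibreFamily q) (HPullback.fst (𝟙 X) q) where
  ev p := fibreEv q (SSet.yonedaEquiv.symm p.2)
  ev_proj p := by
    refine Eq.trans hPullbackEv_fst ?_
    rfl
  ev_map {p p'} α := by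
    refine Eq.trans (fibreEv_square (q := q) (q' := q) (τ := 𝟙 _) (r := 𝟙 X) (l := 𝟙 Y)
      (σ := SSet.yonedaEquiv.symm p.2)
      (ρ := (fibreFamily q).map α)
      (stdSimplex_map_yonedaEquiv α) (evaluation_square_pre _ _)
      (evaluation_square_pre _ _) rfl rfl ?_ ?_ ?_) ?_
    · simp
    · simp
    · simp
    · rw [Category.comp_id]
      rfl
  injective z z' h := hPullbackEv_injective (isEvaluation_evaluation _ _) h
    (fun _ ↦ unit_hom_ext _ _) (fun h ↦ (isEvaluation_evaluation _ _ _).1 h)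
  exists_lift {p Z} y h := by
    obtain ⟨b, hb⟩ := (isEvaluation_evaluation _ _ _).2 (y ≫ HPullback.snd (𝟙 X) q)
    refine exists_hPullbackEv_lift (isEvaluation_evaluation _ _) y
      (CartesianMonoidalCategory.toUnit Z) ?_ b hb
    rw [h]
    rfl

/-! ### Natural homotopy equivalences of families -/

section

variable {X : SSet.{u}}

/-- Functoriality of homotopy sums in the family. -/
def homotopySumMap {F G : X.Elements ⥤ SSet.{u}} (η : F ⟶ G) :
    homotopySum X F ⟶ homotopySum X G where
  app n := ↾fun x ↦ ⟨x.1, (η.app (X.elementsMk n x.1)).app n x.2⟩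
  naturality n m γ := by
    apply ConcreteCategory.hom_ext
    rintro ⟨σ, a⟩
    let α : X.elementsMk n σ ⟶ X.elementsMk m (X.map γ σ) := CategoryOfElements.homMk _ _ γ rfl
    let b : (F.obj (X.elementsMk n σ)).obj n := a
    have h₁ : (η.app (X.elementsMk m (X.map γ σ))).app m ((F.map α).app m
        ((F.obj (X.elementsMk n σ)).map γ b)) = (G.map α).app m
          ((η.app (X.elementsMk n σ)).app m ((F.obj (X.elementsMk n σ)).map γ b)) :=
      ConcreteCategory.congr_hom (NatTrans.congr_app (η.naturality α) m) _
    rw [NatTrans.naturality_apply (η.app (X.elementsMk n σ))] at h₁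
    exact congrArg (fun c ↦ (⟨X.map γ σ, c⟩ : Σ τ : X.obj m, (G.obj (X.elementsMk m τ)).obj m)) h₁

lemma homotopySumMap_comp {F G H : X.Elements ⥤ SSet.{u}} (η : F ⟶ G) (θ : G ⟶ H) :
    homotopySumMap (η ≫ θ) = homotopySumMap η ≫ homotopySumMap θ := rfl

/-- The action of a homotopy of families on homotopy sums. -/
def homotopySumHomotopy {F G : X.Elements ⥤ SSet.{u}}
    (h : F ⋙ tensorRight Δ[1] ⟶ G) : homotopySum X F ⊗ Δ[1] ⟶ homotopySum X G where
  app n := ↾fun x ↦ ⟨x.1.1, (h.app (X.elementsMk n x.1.1)).app n (x.1.2, x.2)⟩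
  naturality n m γ := by
    apply ConcreteCategory.hom_ext
    rintro ⟨⟨σ, a⟩, t⟩
    exact ConcreteCategory.congr_hom ((homotopySumMap h).naturality γ)
      (⟨σ, (a, t)⟩ : Σ τ : X.obj n, ((F ⋙ tensorRight Δ[1]).obj (X.elementsMk n τ)).obj n)

end

section

variable {C : Type*} [Category* C]

/-- Two natural transformations are homotopic if there is a natural homotopy between them. -/
def NatHomotopic {F G : C ⥤ SSet.{u}} (η θ : F ⟶ G) : Prop :=
  ∃ h : F ⋙ tensorRight Δ[1] ⟶ G, (∀ c, SSet.ι₀ ≫ h.app c = η.app c) ∧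
    ∀ c, SSet.ι₁ ≫ h.app c = θ.app c

lemma NatHomotopic.refl {F G : C ⥤ SSet.{u}} (η : F ⟶ G) : NatHomotopic η η :=
  ⟨{ app c := fst _ _ ≫ η.app c
     naturality c d f := by
      change F.map f ▷ Δ[1] ≫ fst _ _ ≫ η.app d = (fst _ _ ≫ η.app c) ≫ G.map f
      simp }, fun _ ↦ rfl, fun _ ↦ rfl⟩

lemma NatHomotopic.whiskerLeft {D : Type*} [Category* D] {F G : C ⥤ SSet.{u}} {η θ : F ⟶ G}
    (h : NatHomotopic η θ) (K : D ⥤ C) :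
    NatHomotopic (Functor.whiskerLeft K η) (Functor.whiskerLeft K θ) := by
  obtain ⟨h, h₀, h₁⟩ := h
  exact ⟨Functor.whiskerLeft K h, fun c ↦ h₀ _, fun c ↦ h₁ _⟩

end

/-- Naturality in the simplices of `X` is what lets the homotopies for the single values assemble
into one homotopy of the sums. -/
lemma NatHomotopic.weakHomotopic {X : SSet.{u}} {F G : X.Elements ⥤ SSet.{u}} {η θ : F ⟶ G}
    (h : NatHomotopic η θ) : WeakHomotopic (homotopySumMap η) (homotopySumMap θ) := by
  obtain ⟨h, h₀, h₁⟩ := h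
  refine WeakHomotopic.of_homotopy (homotopySumHomotopy h) ?_ ?_
  · ext n ⟨σ, a⟩
    have := ConcreteCategory.congr_hom (NatTrans.congr_app (h₀ (X.elementsMk n σ)) n) a
    exact congrArg (fun c ↦ (⟨σ, c⟩ : Σ τ : X.obj n, (G.obj (X.elementsMk n τ)).obj n)) this
  · ext n ⟨σ, a⟩
    have := ConcreteCategory.congr_hom (NatTrans.congr_app (h₁ (X.elementsMk n σ)) n) a
    exact congrArg (fun c ↦ (⟨σ, c⟩ : Σ τ : X.obj n, (G.obj (X.elementsMk n τ)).obj n)) this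

/-! ### The homotopy sum of the fibres of a map, as a functor of the map -/

section

variable {Y X Y' X' : SSet.{u}} {q : Y ⟶ X} {q' : Y' ⟶ X'} {l : Y ⟶ Y'} {r : X ⟶ X'}
  (h₁ : 𝟙 X ≫ r = r ≫ 𝟙 X') (h : q ≫ r = l ≫ q')

lemma pathSection_naturality :
    l ≫ pathSection q' = pathSection q ≫ HPullback.map r l r h₁ h := by
  apply HPullback.hom_ext
  · simp [pathSection, h]
  · simp [pathSection, ← reassoc_of% h, constPath_naturality]
  · simp [pathSection]

lemma pathContraction_naturality :
    HPullback.map r l r h₁ h ▷ Δ[1] ≫ pathContraction q' =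
      pathContraction q ≫ HPullback.map r l r h₁ h := by
  have h : HPullback.map r l r h₁ h ▷ Δ[1] ≫ HPullback.path (𝟙 X') q' ▷ Δ[1] =
      HPullback.path (𝟙 X) q ▷ Δ[1] ≫ (ihom Δ[1]).map r ▷ Δ[1] := by
    rw [← comp_whiskerRight, HPullback.map_path, comp_whiskerRight]
  apply HPullback.hom_ext
  · simp [pathContraction, reassoc_of% h, evalPath_naturality]
  · simp [pathContraction, reassoc_of% h, finalPath, reparam_naturality]
  · simp [pathContraction]

end

/-- The source of the path fibration of a map, functorially in the map. -/
def fibrationTotal : Arrow SSet.{u} ⥤ SSet.{u} where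
  obj q := HPullback (𝟙 q.right) q.hom
  map φ := HPullback.map φ.right φ.left φ.right (by rw [Category.id_comp, Category.comp_id])
    φ.w.symm
  map_id q := by apply HPullback.hom_ext <;> simp
  map_comp φ ψ := by apply HPullback.hom_ext <;> simp

section

variable {q q' : Arrow SSet.{u}} (φ : q ⟶ q')

lemma fibrationTotal_map_fst : fibrationTotal.map φ ≫ HPullback.fst (𝟙 q'.right) q'.hom =
    HPullback.fst (𝟙 q.right) q.hom ≫ φ.right := rfl

lemma fibrationTotal_map_snd : fibrationTotal.map φ ≫ HPullback.snd (𝟙 q'.right) q'.hom =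
    HPullback.snd (𝟙 q.right) q.hom ≫ φ.left := rfl

end

/-- The partial sections of the path fibration of a map, functorially in the map. -/
def fibrationSection : Arrow SSet.{u} ⥤ SSet.{u} where
  obj q := PartialSection (HPullback.fst (𝟙 q.right) q.hom)
  map φ := PartialSection.map (fibrationTotal.map φ) φ.right (fibrationTotal_map_fst φ)
  map_id q := by
    ext n y
    apply Subtype.ext
    change y.1 ≫ fibrationTotal.map (𝟙 q) = y.1
    exact (congrArg (y.1 ≫ ·) (fibrationTotal.map_id q)).trans (Category.comp_id y.1)
  map_comp φ ψ := by
    ext n y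
    apply Subtype.ext
    change y.1 ≫ fibrationTotal.map (φ ≫ ψ) =
      (y.1 ≫ fibrationTotal.map φ) ≫ fibrationTotal.map ψ
    exact (congrArg (y.1 ≫ ·) (fibrationTotal.map_comp φ ψ)).trans (Category.assoc y.1 _ _).symm

/-- The comparison of the homotopy sum of the fibres with partial sections. -/
def fibreSumIso : fibreSum.{u} ≅ fibrationSection :=
  NatIso.ofComponents (fun q ↦ @asIso SSet.{u} _ (homotopySum q.right (fibreFamily q.hom))
    (PartialSection (HPullback.fst (𝟙 q.right) q.hom)) (fibreSectionFamily q.hom).comparison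
    (fibreSectionFamily q.hom).isIso_comparison) (by
    intro q q' φ
    ext n ⟨σ, a⟩
    apply Subtype.ext
    let b : ((fibreFamily q.hom).obj (q.right.elementsMk n σ)).obj n := a
    let ρ : (fibreFamily q.hom).obj (q.right.elementsMk n σ) ⟶
        (fibreFamily q'.hom).obj (q'.right.elementsMk n (φ.right.app n σ)) :=
      PointedMap.fibre.map ((tautologicalMap φ).app (q.right.elementsMk n σ))
    change SSet.stdSimplex.obj n.unop ◁ SSet.yonedaEquiv.symm (ρ.app n b) ≫
        fibreEv q'.hom (SSet.yonedaEquiv.symm (φ.right.app n σ)) =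
      (SSet.stdSimplex.obj n.unop ◁ SSet.yonedaEquiv.symm b ≫
        fibreEv q.hom (SSet.yonedaEquiv.symm σ)) ≫ fibrationTotal.map φ
    have h : SSet.yonedaEquiv.symm (ρ.app n b) = SSet.yonedaEquiv.symm b ≫ ρ :=
      (SSet.yonedaEquiv_symm_comp b ρ).symm
    have h' : SSet.stdSimplex.obj n.unop ◁ ρ ≫
        fibreEv q'.hom (SSet.yonedaEquiv.symm (φ.right.app n σ)) =
          𝟙 _ ▷ _ ≫ fibreEv q.hom (SSet.yonedaEquiv.symm σ) ≫ fibrationTotal.map φ := by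
      refine fibreEv_square ?_ (evaluation_square_map _ φ.left) (evaluation_square_map _ φ.right)
        rfl rfl rfl rfl rfl
      rw [SSet.yonedaEquiv_symm_comp]
      rfl
    rw [h]
    exact congrArg (SSet.stdSimplex.obj n.unop ◁ SSet.yonedaEquiv.symm b ≫ ·) h')

/-- The restriction of partial sections to the diagonal, naturally in the map. -/
def fibrationSectionToTotal : fibrationSection.{u} ⟶ fibrationTotal where
  app q := PartialSection.toTotal (HPullback.fst (𝟙 q.right) q.hom)
  naturality _ _ φ := PartialSection.map_toTotal (fibrationTotal.map φ) φ.right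
    (fibrationTotal_map_fst φ)

/-- The inverse of `fibrationSectionToTotal` up to homotopy. -/
def fibrationTotalToSection : fibrationTotal.{u} ⟶ fibrationSection where
  app q := PartialSection.ofTotal (HPullback.fst (𝟙 q.right) q.hom)
  naturality _ _ φ := (PartialSection.ofTotal_map (fibrationTotal.map φ) φ.right
    (fibrationTotal_map_fst φ)).symm

lemma fibrationTotalToSection_toTotal :
    fibrationTotalToSection.{u} ≫ fibrationSectionToTotal = 𝟙 _ := by
  ext1
  funext q
  exact PartialSection.ofTotal_toTotal (HPullback.fst (𝟙 q.right) q.hom)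

/-- Partial sections can be deformed by the substitution of the maximum, naturally in the map. -/
def fibrationSectionSup : fibrationSection.{u} ⟶ fibrationSection where
  app q := SSet.ι₁ ≫ PartialSection.homotopySup (HPullback.fst (𝟙 q.right) q.hom)
  naturality _ _ _ := rfl

/-- Substitutions act on the source `Δ[n] × Δ[n]` and morphisms of arrows act by composition on the
target, so the two commute definitionally. -/
lemma natHomotopic_id_sup : NatHomotopic (𝟙 fibrationSection.{u}) fibrationSectionSup :=
  ⟨{ app q := PartialSection.homotopySup (HPullback.fst (𝟙 q.right) q.hom)
     naturality _ _ _ := rfl },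
    fun q ↦ PartialSection.ι₀_homotopySup (HPullback.fst (𝟙 q.right) q.hom), fun _ ↦ rfl⟩

lemma natHomotopic_comp_sup :
    NatHomotopic (fibrationSectionToTotal.{u} ≫ fibrationTotalToSection) fibrationSectionSup :=
  ⟨{ app q := PartialSection.homotopySup' (HPullback.fst (𝟙 q.right) q.hom)
     naturality _ _ _ := rfl },
    fun q ↦ PartialSection.ι₀_homotopySup' (HPullback.fst (𝟙 q.right) q.hom),
    fun q ↦ (PartialSection.ι₁_homotopySup (HPullback.fst (𝟙 q.right) q.hom)).symm⟩

/-- The projection of the path fibration of a map to the source of the map. -/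
def fibrationTotalToLeft : fibrationTotal.{u} ⟶ Arrow.leftFunc where
  app q := HPullback.snd (𝟙 q.right) q.hom
  naturality _ _ φ := fibrationTotal_map_snd φ

/-- The inclusion of the constant paths. -/
def leftToFibrationTotal : Arrow.leftFunc ⟶ fibrationTotal.{u} where
  app q := pathSection q.hom
  naturality _ _ φ := pathSection_naturality
    (Category.id_comp _ |>.trans (Category.comp_id _).symm) φ.w.symm

lemma leftToFibrationTotal_toLeft :
    leftToFibrationTotal.{u} ≫ fibrationTotalToLeft = 𝟙 _ := by
  ext1
  funext q
  exact pathSection_snd q.hom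

lemma natHomotopic_id_comp_left :
    NatHomotopic (𝟙 fibrationTotal.{u}) (fibrationTotalToLeft ≫ leftToFibrationTotal) :=
  ⟨{ app q := pathContraction q.hom
     naturality _ _ φ := pathContraction_naturality
       (Category.id_comp _ |>.trans (Category.comp_id _).symm) φ.w.symm },
    fun q ↦ ι₀_pathContraction q.hom, fun q ↦ ι₁_pathContraction q.hom⟩

/-- The projection of the homotopy sum of the fibres to the source of the map. -/
def fibreSumToLeft : fibreSum.{u} ⟶ Arrow.leftFunc :=
  fibreSumIso.hom ≫ fibrationSectionToTotal ≫ fibrationTotalToLeft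

/-- The intermediate `κ` accommodates zigzags: natural homotopies have a direction, and for partial
sections the identity and `η ≫ θ` are only joined through the substitution of the maximum. -/
lemma isWeakEquiv_homotopySumMap {X : SSet.{u}} {C : Type*} [Category* C] (K : X.Elements ⥤ C)
    {F G : C ⥤ SSet.{u}} {η : F ⟶ G} {θ : G ⟶ F} {κ : F ⟶ F} (h : NatHomotopic (𝟙 F) κ)
    (h' : NatHomotopic (η ≫ θ) κ) (e : θ ≫ η = 𝟙 G) :
    IsWeakEquiv (homotopySumMap (Functor.whiskerLeft K η)) := by
  refine isWeakEquiv_of_weakHomotopic _ (homotopySumMap (Functor.whiskerLeft K θ)) ?_ ?_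
  · exact (h'.whiskerLeft K).weakHomotopic.trans (h.whiskerLeft K).weakHomotopic.symm
  · rw [← homotopySumMap_comp, ← Functor.whiskerLeft_comp, e]
    exact .refl _

/-- Each of the three stages (comparison with partial sections, restriction to the diagonal,
contraction of paths) is a homotopy equivalence naturally in the arrow, so it survives summation
over `X`. -/
lemma isWeakEquiv_homotopySumMap_fibreSumToLeft {X : SSet.{u}} (K : X.Elements ⥤ Arrow SSet.{u}) :
    IsWeakEquiv (homotopySumMap (Functor.whiskerLeft K fibreSumToLeft)) := by
  have h₁ : IsWeakEquiv (homotopySumMap (Functor.whiskerLeft K fibreSumIso.hom)) :=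
    isWeakEquiv_homotopySumMap K (.refl _)
      (by rw [Iso.hom_inv_id]; exact .refl _) fibreSumIso.inv_hom_id
  have h₂ : IsWeakEquiv (homotopySumMap (Functor.whiskerLeft K fibrationSectionToTotal)) :=
    isWeakEquiv_homotopySumMap K natHomotopic_id_sup natHomotopic_comp_sup
      fibrationTotalToSection_toTotal
  have h₃ : IsWeakEquiv (homotopySumMap (Functor.whiskerLeft K fibrationTotalToLeft)) :=
    isWeakEquiv_homotopySumMap K natHomotopic_id_comp_left (.refl _) leftToFibrationTotal_toLeft
  rw [fibreSumToLeft, Functor.whiskerLeft_comp, Functor.whiskerLeft_comp, homotopySumMap_comp,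
    homotopySumMap_comp]
  exact h₁.comp (h₂.comp h₃)

/-! ### The families of based loops and of incidence correspondences as families of sections -/

section

variable {K L X : SSet.{u}}

/-- A path in `X ^ K` from the point `σ` to itself becomes, after evaluation on `K`, a path with
both ends at the value of `σ`. Based loops are thus sections of the strict loops, the role of `T` in
`loopSectionFamily`. -/
lemma whiskerLeft_path_pathEv_endpoint (σ : K ⟶ X) (i : Fin 2) :
    (K ◁ HPullback.path (MonoidalClosed.curry' σ) (MonoidalClosed.curry' σ) ≫
      pathEv (evaluation K X)) ≫ endpoint X i = fst _ _ ≫ σ := by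
  have h : HPullback.path (MonoidalClosed.curry' σ) (MonoidalClosed.curry' σ) ≫ endpoint _ i =
      CartesianMonoidalCategory.toUnit _ ≫ MonoidalClosed.curry' σ := by
    revert i
    rw [Fin.forall_fin_two]
    constructor
    · rw [HPullback.path_zero, unit_hom_ext (HPullback.fst _ _)]
    · rw [HPullback.path_one, unit_hom_ext (HPullback.snd _ _)]
  rw [Category.assoc, pathEv_endpoint, ← MonoidalCategory.whiskerLeft_comp_assoc, h,
    MonoidalCategory.whiskerLeft_comp_assoc, whiskerLeft_curry'_evaluation]
  rfl

/-- The evaluation of loops based at a map `σ : K ⟶ X`. -/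
def loopEv (σ : K ⟶ X) :
    K ⊗ HPullback (MonoidalClosed.curry' σ) (MonoidalClosed.curry' σ) ⟶ StrictLoop X :=
  StrictLoop.lift (K ◁ HPullback.path _ _ ≫ pathEv (evaluation K X))
    (by rw [whiskerLeft_path_pathEv_endpoint, whiskerLeft_path_pathEv_endpoint])

lemma loopEv_path (σ : K ⟶ X) : loopEv σ ≫ StrictLoop.path X =
    K ◁ HPullback.path _ _ ≫ pathEv (evaluation K X) := rfl

lemma loopEv_proj (σ : K ⟶ X) : loopEv σ ≫ StrictLoop.proj X = fst _ _ ≫ σ :=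
  whiskerLeft_path_pathEv_endpoint σ 0

lemma loopEv_injective (σ : K ⟶ X) {Z : SSet.{u}}
    {z z' : Z ⟶ HPullback (MonoidalClosed.curry' σ) (MonoidalClosed.curry' σ)}
    (h : K ◁ z ≫ loopEv σ = K ◁ z' ≫ loopEv σ) : z = z' := by
  refine HPullback.hom_ext (unit_hom_ext _ _) ?_ (unit_hom_ext _ _)
  apply ((isEvaluation_evaluation K X).pathEv Z).1
  dsimp only
  rw [MonoidalCategory.whiskerLeft_comp_assoc, MonoidalCategory.whiskerLeft_comp_assoc,
    ← loopEv_path, reassoc_of% h]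

lemma exists_loopEv_lift (σ : K ⟶ X) {Z : SSet.{u}} (y : K ⊗ Z ⟶ StrictLoop X)
    (hy : y ≫ StrictLoop.proj X = fst _ _ ≫ σ) : ∃ z, K ◁ z ≫ loopEv σ = y := by
  obtain ⟨h, hh⟩ := ((isEvaluation_evaluation K X).pathEv Z).2 (y ≫ StrictLoop.path X)
  dsimp only at hh
  have he (i : Fin 2) : h ≫ endpoint _ i =
      CartesianMonoidalCategory.toUnit _ ≫ MonoidalClosed.curry' σ := by
    apply (isEvaluation_evaluation K X Z).1
    dsimp only
    rw [MonoidalCategory.whiskerLeft_comp_assoc, ← pathEv_endpoint, reassoc_of% hh,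
      StrictLoop.path_endpoint, hy, MonoidalCategory.whiskerLeft_comp_assoc,
      whiskerLeft_curry'_evaluation]
    rfl
  refine ⟨HPullback.lift (CartesianMonoidalCategory.toUnit _) h
    (CartesianMonoidalCategory.toUnit _) (he 0) (he 1), ?_⟩
  rw [← cancel_mono (StrictLoop.path X), Category.assoc, loopEv_path,
    ← MonoidalCategory.whiskerLeft_comp_assoc, HPullback.lift_path, hh]

lemma loopEv_square {σ : K ⟶ X} {σ' : L ⟶ X} {κ : L ⟶ K}
    {ρ : HPullback (MonoidalClosed.curry' σ) (MonoidalClosed.curry' σ) ⟶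
      HPullback (MonoidalClosed.curry' σ') (MonoidalClosed.curry' σ')}
    (h : ρ ≫ HPullback.path _ _ =
      HPullback.path _ _ ≫ (ihom Δ[1]).map ((MonoidalClosed.pre κ).app X)) :
    L ◁ ρ ≫ loopEv σ' = κ ▷ _ ≫ loopEv σ := by
  rw [← cancel_mono (StrictLoop.path X), Category.assoc, Category.assoc, loopEv_path, loopEv_path,
    ← MonoidalCategory.whiskerLeft_comp_assoc, h, MonoidalCategory.whiskerLeft_comp_assoc,
    pathEv_square (evaluation_square_pre κ X), whisker_exchange_assoc]
  have e : (ihom Δ[1]).map (𝟙 X) = 𝟙 _ := CategoryTheory.Functor.map_id _ _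
  rw [e, Category.comp_id]

end

/-- The based loops are the sections of the space of loops. -/
def loopSectionFamily (E : SSet.{u}) : SectionFamily (loopFamily E) (StrictLoop.proj E) where
  ev p := loopEv (SSet.yonedaEquiv.symm p.2)
  ev_proj _ := loopEv_proj _
  ev_map _ := loopEv_square rfl
  injective _ _ h := loopEv_injective _ h
  exists_lift y h := exists_loopEv_lift _ y h

/-- The evaluation of free loops. -/
def freeLoopEv (K X : SSet.{u}) :
    K ⊗ HPullback (diag ((ihom K).obj X)) (diag ((ihom K).obj X)) ⟶ HPullback (diag X) (diag X) :=
  hPullbackEv (evaluation K X) (evaluation K X) (pairEv (evaluation K X)) rfl rfl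

lemma isEvaluation_freeLoopEv (K X : SSet.{u}) : IsEvaluation (freeLoopEv K X) :=
  isEvaluation_hPullbackEv (isEvaluation_evaluation K X) (isEvaluation_evaluation K X)
    (isEvaluation_evaluation K X).pairEv

lemma freeLoopEv_square {K L X Y : SSet.{u}} {κ : L ⟶ K} {l : X ⟶ Y}
    {ρ : (ihom K).obj X ⟶ (ihom L).obj Y}
    (h : L ◁ ρ ≫ evaluation L Y = κ ▷ _ ≫ evaluation K X ≫ l) :
    L ◁ freeLoop.map ρ ≫ freeLoopEv L Y = κ ▷ _ ≫ freeLoopEv K X ≫ freeLoop.map l :=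
  hPullbackEv_square h h (pairEv_square h) rfl rfl rfl rfl rfl rfl

lemma freeLoopEv_fst (K X : SSet.{u}) : freeLoopEv K X ≫ HPullback.fst (diag X) (diag X) =
    K ◁ HPullback.fst _ _ ≫ evaluation K X := hPullbackEv_fst

lemma freeLoopEv_snd (K X : SSet.{u}) : freeLoopEv K X ≫ HPullback.snd (diag X) (diag X) =
    K ◁ HPullback.snd _ _ ≫ evaluation K X := hPullbackEv_snd

lemma freeLoopEv_path (K X : SSet.{u}) : freeLoopEv K X ≫ HPullback.path (diag X) (diag X) =
    K ◁ HPullback.path _ _ ≫ pathEv (pairEv (evaluation K X)) := hPullbackEv_path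

lemma freeLoopEv_freeLoopFst (K X : SSet.{u}) :
    freeLoopEv K X ≫ freeLoopFst X = K ◁ freeLoopFst _ ≫ pathEv (evaluation K X) := by
  have h : K ◁ fst _ _ ≫ evaluation K X =
      𝟙 K ▷ _ ≫ pairEv (evaluation K X) ≫ fst X X := rfl
  rw [freeLoopFst, freeLoopFst, MonoidalCategory.whiskerLeft_comp_assoc, pathEv_square h,
    id_whiskerRight, Category.id_comp]
  rw [reassoc_of% freeLoopEv_path]

lemma freeLoopEv_freeLoopSnd (K X : SSet.{u}) :
    freeLoopEv K X ≫ freeLoopSnd X = K ◁ freeLoopSnd _ ≫ pathEv (evaluation K X) := by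
  have h : K ◁ snd _ _ ≫ evaluation K X =
      𝟙 K ▷ _ ≫ pairEv (evaluation K X) ≫ snd X X := rfl
  rw [freeLoopSnd, freeLoopSnd, MonoidalCategory.whiskerLeft_comp_assoc, pathEv_square h,
    id_whiskerRight, Category.id_comp]
  rw [reassoc_of% freeLoopEv_path]

lemma whiskerLeft_constPath_pathEv {K S T : SSet.{u}} (ε : K ⊗ S ⟶ T) :
    K ◁ constPath S ≫ pathEv ε = ε ≫ constPath T := by
  apply MonoidalClosed.uncurry_injective
  rw [uncurry_pathEv, constPath, constPath, MonoidalClosed.uncurry_curry,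
    ← MonoidalClosed.curry_natural_left, MonoidalClosed.uncurry_curry]
  rfl

section

variable (P : PointedMap.{u})

lemma loopToFreeLoop_freeLoopFst :
    P.loopToFreeLoop ≫ freeLoopFst P.B = HPullback.path P.pt P.pt := by
  have h := congrArg (HPullback.path P.pt P.pt ≫ ·) (pathConst_map_fst P.B)
  exact h

lemma loopToFreeLoop_freeLoopSnd :
    P.loopToFreeLoop ≫ freeLoopSnd P.B =
      HPullback.path P.pt P.pt ≫ endpoint P.B 0 ≫ constPath P.B := by
  have h := congrArg (HPullback.path P.pt P.pt ≫ ·) (pathConst_map_snd P.B)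
  exact h

lemma loopToFreeLoop_fst :
    P.loopToFreeLoop ≫ HPullback.fst (diag P.B) (diag P.B) = HPullback.fst P.pt P.pt ≫ P.pt := rfl

lemma loopToFreeLoop_snd :
    P.loopToFreeLoop ≫ HPullback.snd (diag P.B) (diag P.B) = HPullback.snd P.pt P.pt ≫ P.pt := rfl

end

/-- On either side the first path is the loop itself and the second is constant at the basepoint.
The compatibility turns points of the incidence correspondence into points of the homotopy pullback
of `toFreeLoop` and `Λ f`. -/
lemma whiskerLeft_freeLoopEv {K X : SSet.{u}} (σ : K ⟶ X)
    (a : HPullback (MonoidalClosed.curry' σ) (MonoidalClosed.curry' σ) ⟶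
      HPullback (diag ((ihom K).obj X)) (diag ((ihom K).obj X)))
    (h₁ : a ≫ HPullback.fst _ _ = HPullback.fst _ _ ≫ MonoidalClosed.curry' σ)
    (h₂ : a ≫ freeLoopFst _ = HPullback.path _ _)
    (h₃ : a ≫ freeLoopSnd _ = HPullback.path _ _ ≫ endpoint _ 0 ≫ constPath _)
    (h₄ : a ≫ HPullback.snd _ _ = HPullback.snd _ _ ≫ MonoidalClosed.curry' σ) :
    K ◁ a ≫ freeLoopEv K X = loopEv σ ≫ StrictLoop.toFreeLoop X := by
  apply freeLoop_hom_ext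
  · rw [Category.assoc, Category.assoc, freeLoopEv_fst, StrictLoop.toFreeLoop_start, loopEv_proj,
      ← MonoidalCategory.whiskerLeft_comp_assoc, h₁,
      MonoidalCategory.whiskerLeft_comp_assoc, whiskerLeft_curry'_evaluation]
    rfl
  · rw [Category.assoc, Category.assoc, freeLoopEv_freeLoopFst, StrictLoop.toFreeLoop_fst,
      loopEv_path, ← MonoidalCategory.whiskerLeft_comp_assoc, h₂]
  · rw [Category.assoc, Category.assoc, freeLoopEv_freeLoopSnd, StrictLoop.toFreeLoop_snd,
      StrictLoop.proj, Category.assoc, reassoc_of% loopEv_path,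
      ← MonoidalCategory.whiskerLeft_comp_assoc, h₃, MonoidalCategory.whiskerLeft_comp_assoc,
      MonoidalCategory.whiskerLeft_comp_assoc, whiskerLeft_constPath_pathEv,
      reassoc_of% pathEv_endpoint]
  · rw [Category.assoc, Category.assoc, freeLoopEv_snd, StrictLoop.toFreeLoop_end, loopEv_proj,
      ← MonoidalCategory.whiskerLeft_comp_assoc, h₄,
      MonoidalCategory.whiskerLeft_comp_assoc, whiskerLeft_curry'_evaluation]
    rfl

lemma whiskerLeft_loopToFreeLoop_freeLoopEv {K E B : SSet.{u}} (f : E ⟶ B) (σ : K ⟶ B) :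
    K ◁ (PointedMap.mk ((ihom K).map f) (MonoidalClosed.curry' σ)).loopToFreeLoop ≫
      freeLoopEv K B = loopEv σ ≫ StrictLoop.toFreeLoop B :=
  whiskerLeft_freeLoopEv σ _ (loopToFreeLoop_fst _) (loopToFreeLoop_freeLoopFst _)
    (loopToFreeLoop_freeLoopSnd _) (loopToFreeLoop_snd _)

lemma whiskerLeft_freeLoop_map_freeLoopEv (K : SSet.{u}) {E B : SSet.{u}} (f : E ⟶ B) :
    K ◁ freeLoop.map ((ihom K).map f) ≫ freeLoopEv K B = freeLoopEv K E ≫ freeLoop.map f :=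
  (freeLoopEv_square (evaluation_square_map K f)).trans (by rw [id_whiskerRight]; rfl)

section

variable {K L E B : SSet.{u}} (f : E ⟶ B) (σ : K ⟶ B)

/-- The incidence correspondence of the mapping complexes of `K`, based at `σ`. -/
abbrev IncidenceOver : SSet.{u} :=
  PointedMap.incidence.obj ⟨(ihom K).map f, MonoidalClosed.curry' σ⟩

/-- The evaluation of points of incidence correspondences. -/
def incidenceEv : K ⊗ IncidenceOver f σ ⟶ HPullback (StrictLoop.toFreeLoop B) (freeLoop.map f) :=
  hPullbackEv (loopEv σ) (freeLoopEv K E) (freeLoopEv K B)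
    (whiskerLeft_loopToFreeLoop_freeLoopEv f σ) (whiskerLeft_freeLoop_map_freeLoopEv K f)

lemma incidenceEv_proj :
    incidenceEv f σ ≫ HPullback.fst (StrictLoop.toFreeLoop B) (freeLoop.map f) ≫
      StrictLoop.proj B = fst _ _ ≫ σ := by
  have h : incidenceEv f σ ≫ HPullback.fst (StrictLoop.toFreeLoop B) (freeLoop.map f) =
    K ◁ HPullback.fst _ _ ≫ loopEv σ := hPullbackEv_fst
  rw [reassoc_of% h]
  exact congrArg (K ◁ HPullback.fst _ _ ≫ ·) (loopEv_proj σ)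

lemma incidenceEv_injective {Z : SSet.{u}} {z z' : Z ⟶ IncidenceOver f σ}
    (h : K ◁ z ≫ incidenceEv f σ = K ◁ z' ≫ incidenceEv f σ) : z = z' :=
  hPullbackEv_injective (isEvaluation_freeLoopEv K B) h (fun h ↦ loopEv_injective σ h)
    (fun h ↦ (isEvaluation_freeLoopEv K E Z).1 h)

lemma exists_incidenceEv_lift {Z : SSet.{u}}
    (y : K ⊗ Z ⟶ HPullback (StrictLoop.toFreeLoop B) (freeLoop.map f))
    (hy : y ≫ HPullback.fst (StrictLoop.toFreeLoop B) (freeLoop.map f) ≫ StrictLoop.proj B =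
      fst _ _ ≫ σ) : ∃ z, K ◁ z ≫ incidenceEv f σ = y := by
  obtain ⟨a, ha⟩ := exists_loopEv_lift σ
    (y ≫ HPullback.fst (StrictLoop.toFreeLoop B) (freeLoop.map f)) (by rw [Category.assoc, hy])
  obtain ⟨b, hb⟩ := (isEvaluation_freeLoopEv K E Z).2
    (y ≫ HPullback.snd (StrictLoop.toFreeLoop B) (freeLoop.map f))
  exact exists_hPullbackEv_lift (isEvaluation_freeLoopEv K B) y a ha b hb

variable {f σ} in
lemma incidenceEv_square {σ' : L ⟶ B} {κ : L ⟶ K} {ρ : IncidenceOver f σ ⟶ IncidenceOver f σ'}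
    {ρ₁ : HPullback (MonoidalClosed.curry' σ) (MonoidalClosed.curry' σ) ⟶
      HPullback (MonoidalClosed.curry' σ') (MonoidalClosed.curry' σ')}
    (h : ρ₁ ≫ HPullback.path _ _ =
      HPullback.path _ _ ≫ (ihom Δ[1]).map ((MonoidalClosed.pre κ).app B))
    (r₁ : ρ ≫ HPullback.fst _ _ = HPullback.fst _ _ ≫ ρ₁)
    (r₂ : ρ ≫ HPullback.snd _ _ =
      HPullback.snd _ _ ≫ freeLoop.map ((MonoidalClosed.pre κ).app E))
    (r₃ : ρ ≫ HPullback.path _ _ =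
      HPullback.path _ _ ≫ (ihom Δ[1]).map (freeLoop.map ((MonoidalClosed.pre κ).app B))) :
    L ◁ ρ ≫ incidenceEv f σ' = κ ▷ _ ≫ incidenceEv f σ := by
  have e (X : SSet.{u}) : L ◁ freeLoop.map ((MonoidalClosed.pre κ).app X) ≫ freeLoopEv L X =
      κ ▷ _ ≫ freeLoopEv K X ≫ 𝟙 _ := by
    refine (freeLoopEv_square (evaluation_square_pre κ X)).trans ?_
    exact congrArg (fun k ↦ κ ▷ _ ≫ freeLoopEv K X ≫ k) (freeLoop.map_id X)
  refine (hPullbackEv_square (τ := 𝟙 _) (τ₁ := 𝟙 _) (τ₂ := 𝟙 _) (τ₃ := 𝟙 _)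
      (hf := whiskerLeft_loopToFreeLoop_freeLoopEv f σ)
      (hg := whiskerLeft_freeLoop_map_freeLoopEv K f) ?_ (e E) (e B) r₁ r₂ r₃ ?_ ?_ ?_).trans ?_
  · exact (loopEv_square h).trans (congrArg (κ ▷ _ ≫ ·) (Category.comp_id _).symm)
  · simp
  · simp
  · simp
  · rw [Category.comp_id]
    rfl

end

section

variable {E B : SSet.{u}} (f : E ⟶ B)

/-- The evaluation of points of the incidence correspondence of a simplex of `B`. -/
def tautologicalIncidenceEv (p : B.Elements) :
    SSet.stdSimplex.obj p.1.unop ⊗ PointedMap.incidence.obj ((tautological f).obj p) ⟶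
      HPullback (StrictLoop.toFreeLoop B) (freeLoop.map f) :=
  incidenceEv (K := SSet.stdSimplex.obj p.1.unop) f (SSet.yonedaEquiv.symm p.2)

lemma tautologicalIncidenceEv_map {p q : B.Elements} (α : p ⟶ q) :
    SSet.stdSimplex.obj q.1.unop ◁ PointedMap.incidence.map ((tautological f).map α) ≫
      tautologicalIncidenceEv f q =
        SSet.stdSimplex.map α.1.unop ▷ PointedMap.incidence.obj ((tautological f).obj p) ≫
          tautologicalIncidenceEv f p := by
  refine incidenceEv_square (f := f) (κ := SSet.stdSimplex.map α.1.unop)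
    (σ := SSet.yonedaEquiv.symm p.2) (σ' := SSet.yonedaEquiv.symm q.2)
    (ρ := PointedMap.incidence.map ((tautological f).map α))
    (ρ₁ := PointedMap.loop.map ((tautological f).map α)) ?_ ?_ ?_ ?_
  · rfl
  · rfl
  · rfl
  · rfl

lemma tautologicalIncidenceEv_injective {p : B.Elements} {Z : SSet.{u}}
    {z z' : Z ⟶ PointedMap.incidence.obj ((tautological f).obj p)}
    (h : SSet.stdSimplex.obj p.1.unop ◁ z ≫ tautologicalIncidenceEv f p =
      SSet.stdSimplex.obj p.1.unop ◁ z' ≫ tautologicalIncidenceEv f p) : z = z' :=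
  incidenceEv_injective (K := SSet.stdSimplex.obj p.1.unop) f (SSet.yonedaEquiv.symm p.2) h

lemma exists_tautologicalIncidenceEv_lift {p : B.Elements} {Z : SSet.{u}}
    (y : SSet.stdSimplex.obj p.1.unop ⊗ Z ⟶ HPullback (StrictLoop.toFreeLoop B) (freeLoop.map f))
    (hy : y ≫ HPullback.fst (StrictLoop.toFreeLoop B) (freeLoop.map f) ≫ StrictLoop.proj B =
      fst _ _ ≫ SSet.yonedaEquiv.symm p.2) :
    ∃ z, SSet.stdSimplex.obj p.1.unop ◁ z ≫ tautologicalIncidenceEv f p = y :=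
  exists_incidenceEv_lift (K := SSet.stdSimplex.obj p.1.unop) f (SSet.yonedaEquiv.symm p.2) y hy

/-- The incidence correspondences are the sections of the space of pairs of a loop in `B` and a
free loop in `E` over it. -/
def incidenceSectionFamily :
    SectionFamily (tautological f ⋙ PointedMap.incidence)
      (HPullback.fst (StrictLoop.toFreeLoop B) (freeLoop.map f) ≫ StrictLoop.proj B) where
  ev p := tautologicalIncidenceEv f p
  ev_proj p := incidenceEv_proj (K := SSet.stdSimplex.obj p.1.unop) f (SSet.yonedaEquiv.symm p.2)
  ev_map α := tautologicalIncidenceEv_map f α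
  injective z z' h := tautologicalIncidenceEv_injective f (z := z) (z' := z') h
  exists_lift y h := exists_tautologicalIncidenceEv_lift f y h

end

/-! ### The homotopy sum formulas -/

lemma nonempty_homotopy_hPullback {A B C : SSet.{u}} (f : A ⟶ C) (g : B ⟶ C) :
    Nonempty (SSet.Homotopy (HPullback.fst f g ≫ f) (HPullback.snd f g ≫ g)) :=
  ⟨homotopyMk (HPullback.path f g ▷ Δ[1] ≫ evalPath C) (HPullback.path_zero f g)
    (HPullback.path_one f g)⟩

lemma nonempty_homotopy_comp {X' X Y Y' : SSet.{u}} (a : X' ⟶ X) {f g : X ⟶ Y}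
    (h : Nonempty (SSet.Homotopy f g)) (b : Y ⟶ Y') :
    Nonempty (SSet.Homotopy (a ≫ f ≫ b) (a ≫ g ≫ b)) := by
  obtain ⟨h⟩ := h
  refine ⟨homotopyMk (a ▷ Δ[1] ≫ h.h ≫ b) ?_ ?_⟩
  · exact congrArg (fun k ↦ a ≫ k ≫ b) h.h₀
  · exact congrArg (fun k ↦ a ≫ k ≫ b) h.h₁

/-- A simplicial set is the homotopy sum of the fibres of a map from it. -/
lemma equivOver_fibreFamily {Y X : SSet.{u}} (q : Y ⟶ X) :
    EquivOver (homotopySumProj X (fibreFamily q)) q := by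
  refine ⟨(fibreSectionFamily q).toTotal ≫ HPullback.snd (𝟙 X) q,
    (fibreSectionFamily q).isWeakEquiv_toTotal.comp (isWeakEquiv_snd_id q), ?_⟩
  -- The sum lies over `X` through the start of the path in `HPullback (𝟙 X) q`, whereas `q` sees
  -- its end; the path itself is the required homotopy.
  have h := nonempty_homotopy_comp (fibreSectionFamily q).toTotal
    (nonempty_homotopy_hPullback (𝟙 X) q) (𝟙 X)
  rwa [Category.comp_id, Category.comp_id, Category.comp_id, (fibreSectionFamily q).toTotal_proj,
    ← Category.assoc] at h

/-- The free loop space of a Kan complex is the homotopy sum of the based loop spaces. -/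
lemma equivOver_loopFamily (E : SSet.{u}) [SSet.KanComplex E] :
    EquivOver (homotopySumProj E (loopFamily E)) (freeLoopProj E) := by
  obtain ⟨d⟩ := StrictLoop.nonempty_deformationRetract_toFreeLoop (X := E)
  refine ⟨(loopSectionFamily E).toTotal ≫ StrictLoop.toFreeLoop E,
    (loopSectionFamily E).isWeakEquiv_toTotal.comp d.isWeakEquiv, homotopy_of_eq ?_⟩
  exact (loopSectionFamily E).toTotal_proj.symm

/-- This is a base change of the inclusion of strict loops along `Λ f`. Being a deformation retract,
and not just a weak equivalence, is what path lifting in the Kan complex `Λ B` transports. -/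
lemma isWeakEquiv_incidence {E B : SSet.{u}} [SSet.KanComplex B] (f : E ⟶ B) :
    IsWeakEquiv (HPullback.snd (StrictLoop.toFreeLoop B) (freeLoop.map f)) := by
  obtain ⟨d⟩ := StrictLoop.nonempty_deformationRetract_toFreeLoop (X := B)
  have : SSet.KanComplex (HPullback (diag B) (diag B)) := HPullback.kanComplex _ _
  exact d.isWeakEquiv_snd (freeLoop.map f)

/-- The free loop space of `E` is the homotopy sum of the incidence correspondences of a map from
`E` to a Kan complex. -/
lemma equivOver_incidence {E B : SSet.{u}} [SSet.KanComplex B] (f : E ⟶ B) :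
    EquivOver (homotopySumProj B (tautological f ⋙ PointedMap.incidence))
      (freeLoopProj E ≫ f) := by
  refine ⟨(incidenceSectionFamily f).toTotal ≫
    HPullback.snd (StrictLoop.toFreeLoop B) (freeLoop.map f),
    (incidenceSectionFamily f).isWeakEquiv_toTotal.comp (isWeakEquiv_incidence f), ?_⟩
  -- The homotopy between the two maps to `Λ B` is pushed to `B` by taking basepoints.
  have h := nonempty_homotopy_comp (incidenceSectionFamily f).toTotal
    (nonempty_homotopy_hPullback (StrictLoop.toFreeLoop B) (freeLoop.map f))
    (HPullback.fst (diag B) (diag B))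
  rw [Category.assoc, StrictLoop.toFreeLoop_start, (incidenceSectionFamily f).toTotal_proj] at h
  exact h

/-- The inner sums are replaced by `𝕀_b` without touching the simplex of `B`, so the triangle over
`B` commutes strictly. -/
lemma isWeakEquiv_fixpointSumFamily {E B : SSet.{u}} (f : E ⟶ B) :
    ∃ w : homotopySum B (fixpointSumFamily f) ⟶
      homotopySum B (tautological f ⋙ PointedMap.incidence), IsWeakEquiv w ∧
      w ≫ homotopySumProj B (tautological f ⋙ PointedMap.incidence) =
        homotopySumProj B (fixpointSumFamily f) :=
  ⟨homotopySumMap (Functor.whiskerLeft (tautological f ⋙ PointedMap.incidenceArrow)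
    fibreSumToLeft), isWeakEquiv_homotopySumMap_fibreSumToLeft _, rfl⟩

/-- The free loop space of `E` is the iterated homotopy sum of the fibres of the incidence
correspondences of a map from `E` to a Kan complex. -/
lemma equivOver_fixpointSumFamily {E B : SSet.{u}} [SSet.KanComplex B] (f : E ⟶ B) :
    EquivOver (homotopySumProj B (fixpointSumFamily f)) (freeLoopProj E ≫ f) := by
  obtain ⟨w, hw, e⟩ := isWeakEquiv_fixpointSumFamily f
  obtain ⟨w', hw', h⟩ := equivOver_incidence f
  refine ⟨w ≫ w', hw.comp hw', ?_⟩
  have h' := nonempty_homotopy_comp w h (𝟙 B)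
  rwa [Category.comp_id, Category.comp_id, e, ← Category.assoc] at h'

end

end HomotopySum

theorem mainTheorem1 {E B : SSet.{u}} [SSet.KanComplex E] [SSet.KanComplex B] (f : E ⟶ B) :
    -- `∫_{x ∈ E} Ω_x E ≃ Λ E`, over `E`
    EquivOver (homotopySumProj E (loopFamily E)) (freeLoopProj E) ∧
    -- `∫_{γ ∈ Λ B} F^γ ≃ Λ E`, over `Λ B`, where `F^γ` is the fibre of `Λ E ⟶ Λ B` over `γ`
    EquivOver (homotopySumProj (freeLoop.obj B) (fibreFamily (freeLoop.map f)))
      (freeLoop.map f) ∧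
    -- `∫_{b ∈ B} ∫_{γ ∈ Ω_b B} F^γ ≃ Λ E`, over `B`, where `F^γ` is the fibre of `𝕀_b ⟶ Ω_b B`
    EquivOver (homotopySumProj B (fixpointSumFamily f)) (freeLoopProj E ≫ f) ∧
    -- for `γ ∈ Ω_b B`, the two descriptions of `F^γ` agree, over `Λ E`
    (∀ (b : 𝟙_ SSet.{u} ⟶ B) (γ : 𝟙_ SSet.{u} ⟶ PointedMap.loop.obj ⟨f, b⟩),
      EquivOver
        (PointedMap.fibreToE ⟨freeLoop.map f, γ ≫ PointedMap.loopToFreeLoop ⟨f, b⟩⟩)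
        (PointedMap.fibreToE ⟨PointedMap.incidenceToLoop.app ⟨f, b⟩, γ⟩ ≫
          PointedMap.incidenceToFreeLoop ⟨f, b⟩)) := by
  refine ⟨equivOver_loopFamily E, equivOver_fibreFamily (freeLoop.map f),
    equivOver_fixpointSumFamily f, fun b γ ↦ ?_⟩
  -- By definition, the fibre of `𝕀_b ⟶ Ω_b B` is the iterated homotopy pullback, and the fibre over
  -- the image of `γ` in `Λ B` is the homotopy pullback of the composite.
  exact equivOver_fibre_iterated γ (PointedMap.loopToFreeLoop ⟨f, b⟩) (freeLoop.map f)
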